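/- Let $G_n=\sum_{m=0}^{n}\left(\prod_{j=1}^{m}\frac{2j-1}{2j}\right)^2$, $n=0,1,2,\dots$, be the Landau constants, let $\gamma$ be Euler's constant, and put $N=n+1$. Assume that $\alpha_1,\alpha_2,\dots$ are the (real) coefficients in the asymptotic expansion $$\pi G_n\sim \ln(16N)+\gamma+\sum_{k=1}^{\infty}\frac{\alpha_k}{N^k},\qquad n\to\infty,$$ that is, for every $l\ge 0$, $\pi G_n-\ln(16N)-\gamma-\sum_{k=1}^{l}\alpha_k N^{-k}=o(N^{-l})$ as $n\to\infty$. Then, as $k\to\infty$, $$\alpha_{2k}=(-1)^{k+1}\,\frac{2\,(2k-2)!}{(2\pi)^{2k}}\left(1+O\!\left(\frac1k\right)\right)$$ and $$\alpha_{2k+1}=(-1)^{k+1}\,\frac{8\,(2k)!\,\ln(2k+1)}{(2\pi)^{2k+2}}\left(1+O\!\left(\frac1{\ln k}\right)\right).$$ -/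

import Mathlib

open Filter Asymptotics
open scoped Nat Topology

noncomputable section

/-- The Landau constants
`G_n = 1 + (1/2)^2 + ((1*3)/(2*4))^2 + ... + ((1*3*...*(2n-1))/(2*4*...*(2n)))^2`. -/
def landauG (n : ℕ) : ℝ :=
  ∑ m ∈ Finset.range (n + 1), (∏ j ∈ Finset.Icc 1 m, (2 * (j : ℝ) - 1) / (2 * (j : ℝ))) ^ 2

/-- The truncation `A_l(N) = ln (16 N) + γ + ∑_{k=1}^l α_k / N^k`. -/
def truncation (α : ℕ → ℝ) (l : ℕ) (N : ℝ) : ℝ :=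
  Real.log (16 * N) + Real.eulerMascheroniConstant + ∑ k ∈ Finset.Icc 1 l, α k / N ^ k

/-- `α_1, α_2, ...` are the coefficients in the (Poincaré) asymptotic expansion
`π G_n ~ ln (16 N) + γ + ∑_{k ≥ 1} α_k / N^k` as `n → ∞`, where `N = n + 1`: for every `l ≥ 0`,
the error made by truncating after the `l`-th term is `o(N^{-l})`. The value `α 0` plays no role. -/
def IsLandauExpansion (α : ℕ → ℝ) : Prop :=
  ∀ l : ℕ, (fun n : ℕ => Real.pi * landauG n - truncation α l ((n : ℝ) + 1))
    =o[atTop] (fun n : ℕ => 1 / ((n : ℝ) + 1) ^ l)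

end

/-! The expansion is handled by a formal Borel transform, sending `1/N^(k+1)` to `t^k/k!`. The
summands `a_m` of `G_n` satisfy `(N+1)² a_{N+1} = (N+1/2)² a_N`. Under the transform the shift `N ↦
N+1` becomes multiplication by `e^{-t}` and division by `N` becomes integration, so the transform
`φ` of the expansion of `π a_N` solves a second order linear equation. For `ψ = e^{t/4} φ` this
equation is self-adjoint, `16 (sinh(t/2) ψ')' = -sinh(t/2) ψ`. Its regular solution is even, and
with `t = 2πi√v` it becomes a series `W(v)` solving `ϑ(S ϑW) = (π²/16) v S W`, where `ϑ = v d/dv`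
and `S = sin(π√v)/(π√v)`; that is, `W = P_{-1/2}(cos π√v)`.

Since `πG_{n+1} - πG_n = π a_{n+1}`, the transform of the `α_k` is recovered from `W` by dividing by
`S`. Splitting `e^{t/4}` into `cosh` and `sinh` separates parities: the `α_{2k}` come from the
coefficients of `W · (π√v/2)/sin(π√v/2)`, the `α_{2k+1}` from those of `W/S` times
`sin(π√v/2)/(π√v/2)` (`one_sub_X_mul_borelTransform`).

The growth is governed by `v = 1`, the zero of `S` nearest to the origin, where `W` has a
logarithmic singularity. Because `1/S` is `2/(1-v)` plus a series with coefficients `O(4^{-m})`, a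
bootstrap on the recursion gives `n W_n → 2τ`, where `τ` is the value at `v = 1` of the flux `S ϑW`.
To find `τ`, `W` is identified with `F(z) = ∑ a_m z^m` at `z = sin²(π√v/2)` by a Wronskian argument.
The flux `z(1-z)F'` has partial sums `n a_n`, so Abel's theorem and Wallis' product give `τ = 1/π`
(`tsum_coeff_flux`).

Hence `W_n ≈ 2/(πn)`. The half-angle factors are regular up to `v = 4` and enter only through their
values `π/2` and `2/π` at `v = 1`, so the two products have coefficients `≈ 1/n` and `≈ (8/π²) log
n`. -/

open PowerSeries (mk coeff)
open scoped PowerSeries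

noncomputable section

/-! ### Asymptotic expansions in powers of `1 / (n + 1)` and their Borel transforms -/

section

/-- `u n` has the asymptotic expansion `∑ p_k / (n + 1) ^ k` as `n → ∞`. -/
def HasExpansion (u : ℕ → ℝ) (p : ℝ⟦X⟧) : Prop :=
  ∀ l : ℕ, (fun n : ℕ => u n - ∑ k ∈ Finset.range l, coeff k p * (((n : ℝ) + 1)⁻¹) ^ k)
    =O[atTop] (fun n : ℕ => (((n : ℝ) + 1)⁻¹) ^ l)

namespace HasExpansion

lemma inv_pow_isBigO_of_le {k l : ℕ} (h : l ≤ k) :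
    (fun n : ℕ => (((n : ℝ) + 1)⁻¹) ^ k) =O[atTop] (fun n : ℕ => (((n : ℝ) + 1)⁻¹) ^ l) := by
  refine IsBigO.of_bound 1 (Eventually.of_forall fun n => ?_)
  have h0 : (0 : ℝ) ≤ ((n : ℝ) + 1)⁻¹ := by positivity
  have h1 : ((n : ℝ) + 1)⁻¹ ≤ 1 := inv_le_one_of_one_le₀ (by linarith [n.cast_nonneg (α := ℝ)])
  rw [one_mul, Real.norm_of_nonneg (by positivity), Real.norm_of_nonneg (by positivity)]
  exact pow_le_pow_of_le_one h0 h1 h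

variable {u v : ℕ → ℝ} {p q : ℝ⟦X⟧}

lemma congr' (h : HasExpansion u p) (huv : u =ᶠ[atTop] v) : HasExpansion v p := by
  intro l
  refine (h l).congr' ?_ EventuallyEq.rfl
  filter_upwards [huv] with n hn
  rw [hn]

lemma add (hu : HasExpansion u p) (hv : HasExpansion v q) :
    HasExpansion (fun n => u n + v n) (p + q) := by
  intro l
  refine ((hu l).add (hv l)).congr_left fun n => ?_
  simp only [map_add, add_mul, Finset.sum_add_distrib]
  ring

lemma smul (c : ℝ) (hu : HasExpansion u p) : HasExpansion (fun n => c * u n) (c • p) := by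
  intro l
  refine ((hu l).const_mul_left c).congr_left fun n => ?_
  simp only [PowerSeries.coeff_smul, smul_eq_mul, mul_sub, Finset.mul_sum, mul_assoc]

lemma sub (hu : HasExpansion u p) (hv : HasExpansion v q) :
    HasExpansion (fun n => u n - v n) (p - q) := by
  have := hu.add (hv.smul (-1))
  simpa [sub_eq_add_neg] using this

lemma zero : HasExpansion (fun _ => 0) 0 := by
  intro l
  simpa using isBigO_zero (fun n : ℕ => (((n : ℝ) + 1)⁻¹) ^ l) atTop

lemma sum {ι : Type*} (s : Finset ι) {u : ι → ℕ → ℝ} {p : ι → ℝ⟦X⟧}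
    (h : ∀ i ∈ s, HasExpansion (u i) (p i)) :
    HasExpansion (fun n => ∑ i ∈ s, u i n) (∑ i ∈ s, p i) := by
  classical
  induction s using Finset.induction_on with
  | empty => simpa using zero
  | insert a s ha ih =>
    simp only [Finset.sum_insert ha]
    exact (h a (by simp)).add (ih fun i hi => h i (by simp [hi]))

lemma one : HasExpansion (fun _ => 1) 1 := by
  intro l
  rcases l with _ | l
  · simpa using isBigO_refl (fun _ : ℕ => (1 : ℝ)) atTop
  · refine (isBigO_zero (fun n : ℕ => (((n : ℝ) + 1)⁻¹) ^ (l + 1)) atTop).congr_left fun n => ?_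
    simp [PowerSeries.coeff_one]

lemma inv_mul (hu : HasExpansion u p) :
    HasExpansion (fun n : ℕ => ((n : ℝ) + 1)⁻¹ * u n) (PowerSeries.X * p) := by
  intro l
  rcases l with _ | l
  · have h1 := (inv_pow_isBigO_of_le (zero_le_one' ℕ)).mul (hu 0)
    refine (h1.congr_left fun n => ?_).congr_right fun n => ?_ <;> simp
  · have h1 := (isBigO_refl (fun n : ℕ => ((n : ℝ) + 1)⁻¹) atTop).mul (hu l)
    refine (h1.congr_left fun n => ?_).congr_right fun n => ?_
    · rw [Finset.sum_range_succ']
      simp only [PowerSeries.coeff_succ_X_mul, PowerSeries.coeff_zero_X_mul, mul_sub,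
        Finset.mul_sum]
      simp only [zero_mul, add_zero]
      congr 1
      refine Finset.sum_congr rfl fun i _ => ?_
      ring
    · ring

/-- Dividing by `1 + 1/N ≥ 1` does not enlarge an error term. This allows the powers of `1/(N+1)` to
be expanded by induction on the exponent. -/
lemma of_one_add_inv_mul
    (h : HasExpansion (fun n : ℕ => (1 + ((n : ℝ) + 1)⁻¹) * u n) ((1 + PowerSeries.X) * p)) :
    HasExpansion u p := by
  intro l
  have key : ∀ x : ℝ, (1 + x) * ∑ k ∈ Finset.range l, coeff k p * x ^ k =
      ∑ k ∈ Finset.range (l + 1), coeff k ((1 + PowerSeries.X) * p) * x ^ k -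
        coeff l p * x ^ l := by
    intro x
    have h1 : ∑ k ∈ Finset.range (l + 1), coeff k (PowerSeries.X * p) * x ^ k =
        x * ∑ k ∈ Finset.range l, coeff k p * x ^ k := by
      rw [Finset.sum_range_succ', Finset.mul_sum]
      simp only [PowerSeries.coeff_succ_X_mul, PowerSeries.coeff_zero_X_mul, zero_mul, add_zero]
      refine Finset.sum_congr rfl fun i _ => ?_
      ring
    simp only [add_mul, one_mul, map_add, Finset.sum_add_distrib]
    rw [h1, Finset.sum_range_succ]
    ring
  have h2 : (fun n : ℕ => (1 + ((n : ℝ) + 1)⁻¹) *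
      (u n - ∑ k ∈ Finset.range l, coeff k p * (((n : ℝ) + 1)⁻¹) ^ k)) =O[atTop]
      (fun n : ℕ => (((n : ℝ) + 1)⁻¹) ^ l) := by
    have h3 := ((h (l + 1)).trans (inv_pow_isBigO_of_le (Nat.le_succ l))).add
      ((isBigO_refl (fun n : ℕ => (((n : ℝ) + 1)⁻¹) ^ l) atTop).const_mul_left (coeff l p))
    refine h3.congr_left fun n => ?_
    rw [mul_sub, key]
    ring
  refine IsBigO.trans ?_ h2
  refine IsBigO.of_bound 1 (Eventually.of_forall fun n => ?_)
  have h0 : (0 : ℝ) ≤ ((n : ℝ) + 1)⁻¹ := by positivity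
  rw [one_mul, norm_mul, Real.norm_of_nonneg (by positivity : (0 : ℝ) ≤ 1 + ((n : ℝ) + 1)⁻¹)]
  exact le_mul_of_one_le_left (norm_nonneg _) (by linarith)

/-- A first nonzero coefficient, at index `l`, would force `N^{-l} = O(N^{-l-1})`. -/
lemma eq_zero (h : HasExpansion (fun _ => 0) p) : p = 0 := by
  ext l
  induction l using Nat.strong_induction_on with
  | _ l ih =>
    have h1 := h (l + 1)
    have h2 : ∀ x : ℝ, 0 - ∑ k ∈ Finset.range (l + 1), coeff k p * x ^ k = -coeff l p * x ^ l := by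
      intro x
      rw [Finset.sum_range_succ, Finset.sum_eq_zero]
      · ring
      · intro k hk
        rw [ih k (Finset.mem_range.1 hk)]
        simp
    simp only [h2] at h1
    have h3 : (fun n : ℕ => (((n : ℝ) + 1)⁻¹) ^ (l + 1)) =o[atTop]
        (fun n : ℕ => (((n : ℝ) + 1)⁻¹) ^ l) := by
      have ht : Tendsto (fun n : ℕ => ((n : ℝ) + 1)⁻¹) atTop (𝓝 0) := by
        simpa [one_div] using tendsto_one_div_add_atTop_nhds_zero_nat (𝕜 := ℝ)
      have := ((isLittleO_one_iff ℝ).2 ht).mul_isBigO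
        (isBigO_refl (fun n : ℕ => (((n : ℝ) + 1)⁻¹) ^ l) atTop)
      refine (this.congr_left fun n => ?_).congr_right fun n => ?_ <;> ring
    have h4 := h1.trans_isLittleO h3
    by_contra hne
    have hne' : coeff l p ≠ 0 := by simpa using hne
    have h5 : (fun n : ℕ => (((n : ℝ) + 1)⁻¹) ^ l) =o[atTop]
        (fun n : ℕ => (((n : ℝ) + 1)⁻¹) ^ l) :=
      (isLittleO_const_mul_left_iff (neg_ne_zero.2 hne')).1 h4
    have h6 := isLittleO_irrefl (f'' := fun n : ℕ => (((n : ℝ) + 1)⁻¹) ^ l) (l := atTop)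
      (Frequently.of_forall fun n => by positivity)
    exact h6 h5

lemma unique (h : HasExpansion u p) (h' : HasExpansion u q) : p = q := by
  have := h.sub h'
  simp only [sub_self] at this
  exact sub_eq_zero.1 this.eq_zero

end HasExpansion

/-! ### The shift `N ↦ N + 1` -/

/-- The coefficient of `X ^ m` in `(X / (1 + X)) ^ k`. -/
def shiftCoeff : ℕ → ℕ → ℝ
  | 0, 0 => 1
  | 0, _ + 1 => 0
  | _ + 1, 0 => 0
  | m + 1, k + 1 => (-1) ^ (m + k) * (m.choose k : ℝ)

lemma shiftCoeff_of_lt {m k : ℕ} (h : m < k) : shiftCoeff m k = 0 := by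
  rcases m with _ | m <;> rcases k with _ | k
  · omega
  · rfl
  · omega
  · simp [shiftCoeff, Nat.choose_eq_zero_of_lt (by omega : m < k)]

/-- Pascal's rule; it encodes `(1 + X) (X/(1+X))^(k+1) = X (X/(1+X))^k`. -/
lemma shiftCoeff_recurrence (m k : ℕ) :
    shiftCoeff (m + 1) (k + 1) + shiftCoeff m (k + 1) = shiftCoeff m k := by
  rcases m with _ | m
  · rcases k with _ | k <;> simp [shiftCoeff]
  · rcases k with _ | k
    · simp [shiftCoeff, pow_succ]
    · simp only [shiftCoeff, Nat.choose_succ_succ]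
      push_cast
      ring

/-- The substitution `X ↦ X / (1 + X)`, i.e. the effect of `N ↦ N + 1` on expansions in `1 / N`. -/
def shiftSeries (p : ℝ⟦X⟧) : ℝ⟦X⟧ :=
  mk fun m => ∑ k ∈ Finset.range (m + 1), coeff k p * shiftCoeff m k

lemma hasExpansion_inv_succ_pow (k : ℕ) :
    HasExpansion (fun n : ℕ => (((n + 1 : ℕ) : ℝ) + 1)⁻¹ ^ k) (mk fun m => shiftCoeff m k) := by
  induction k with
  | zero =>
    have : (mk fun m => shiftCoeff m 0) = (1 : ℝ⟦X⟧) := by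
      ext m
      rcases m with _ | m <;> simp [shiftCoeff, PowerSeries.coeff_one]
    rw [this]
    simpa using HasExpansion.one
  | succ k ih =>
    apply HasExpansion.of_one_add_inv_mul
    have h1 : ((1 + PowerSeries.X) * mk fun m => shiftCoeff m (k + 1) : ℝ⟦X⟧) =
        PowerSeries.X * mk fun m => shiftCoeff m k := by
      ext m
      rcases m with _ | m
      · simp [add_mul, shiftCoeff]
      · simp [add_mul, PowerSeries.coeff_succ_X_mul, shiftCoeff_recurrence]
    rw [h1]
    refine ih.inv_mul.congr' (Eventually.of_forall fun n => ?_)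
    push_cast
    have h0 : (0 : ℝ) ≤ n := n.cast_nonneg
    have : ((n : ℝ) + 1 + 1)⁻¹ * (1 + ((n : ℝ) + 1)⁻¹) = ((n : ℝ) + 1)⁻¹ := by
      field_simp
    rw [pow_succ]
    linear_combination (-((n : ℝ) + 1 + 1)⁻¹ ^ k) * this

/-- Since `(X/(1+X))^k` starts at `X^k`, only the finitely many `k < l` matter at order `l`, and the
expansion can be substituted term by term. -/
lemma HasExpansion.shift {u : ℕ → ℝ} {p : ℝ⟦X⟧} (h : HasExpansion u p) :
    HasExpansion (fun n => u (n + 1)) (shiftSeries p) := by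
  intro l
  have h1 : (fun n : ℕ => u (n + 1) -
      ∑ k ∈ Finset.range l, coeff k p * ((((n + 1 : ℕ) : ℝ) + 1)⁻¹) ^ k)
      =O[atTop] (fun n : ℕ => (((n : ℝ) + 1)⁻¹) ^ l) := by
    refine ((h l).comp_tendsto (tendsto_add_atTop_nat 1)).trans ?_
    refine IsBigO.of_bound 1 (Eventually.of_forall fun n => ?_)
    simp only [Function.comp_apply]
    rw [one_mul, Real.norm_of_nonneg (by positivity), Real.norm_of_nonneg (by positivity)]
    push_cast
    gcongr
    linarith
  have h2 := HasExpansion.sum (Finset.range l)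
    (fun k _ => (hasExpansion_inv_succ_pow k).smul (coeff k p)) l
  refine (h1.add h2).congr_left fun n => ?_
  have h3 : ∀ m ∈ Finset.range l, coeff m (∑ k ∈ Finset.range l,
      coeff k p • (mk fun m => shiftCoeff m k : ℝ⟦X⟧)) = coeff m (shiftSeries p) := by
    intro m hm
    have hm' := Finset.mem_range.1 hm
    simp only [map_sum, PowerSeries.coeff_smul, PowerSeries.coeff_mk, smul_eq_mul, shiftSeries]
    symm
    refine Finset.sum_subset (fun k hk => ?_) (fun k _ hk => ?_)
    · simp only [Finset.mem_range] at hk ⊢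
      omega
    · rw [shiftCoeff_of_lt (by simp only [Finset.mem_range] at hk; omega), mul_zero]
  have h4 := Finset.sum_congr rfl fun m hm =>
    congrArg (· * (((n : ℝ) + 1)⁻¹) ^ m) (h3 m hm)
  simp only at h4 ⊢
  rw [h4]
  ring

/-! ### The formal Borel transform -/

/-- The Borel transform `∑ p_k X ^ k ↦ ∑ p_{k+1} X ^ k / k!`. -/
def borelTransform (p : ℝ⟦X⟧) : ℝ⟦X⟧ := mk fun n => coeff (n + 1) p / (n ! : ℝ)

lemma borelTransform_add (p q : ℝ⟦X⟧) :
    borelTransform (p + q) = borelTransform p + borelTransform q := by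
  ext n
  simp [borelTransform, add_div]

lemma borelTransform_sub (p q : ℝ⟦X⟧) :
    borelTransform (p - q) = borelTransform p - borelTransform q := by
  ext n
  simp [borelTransform, sub_div]

lemma borelTransform_smul (c : ℝ) (p : ℝ⟦X⟧) : borelTransform (c • p) = c • borelTransform p := by
  ext n
  simp [borelTransform, mul_div_assoc]

lemma derivative_borelTransform_X_mul (p : ℝ⟦X⟧) :
    PowerSeries.derivative ℝ (borelTransform (PowerSeries.X * p)) = borelTransform p := by
  ext n
  rw [PowerSeries.coeff_derivative]
  simp only [borelTransform, PowerSeries.coeff_mk, PowerSeries.coeff_succ_X_mul, Nat.factorial_succ]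
  push_cast
  field_simp

/-- The power series of `exp (c t)`. -/
def expSeries (c : ℝ) : ℝ⟦X⟧ := PowerSeries.rescale c (PowerSeries.exp ℝ)

lemma coeff_expSeries (c : ℝ) (n : ℕ) : coeff n (expSeries c) = c ^ n / (n ! : ℝ) := by
  simp [expSeries, PowerSeries.coeff_exp, div_eq_mul_inv]

lemma constantCoeff_expSeries (c : ℝ) : PowerSeries.constantCoeff (expSeries c) = 1 := by
  rw [← PowerSeries.coeff_zero_eq_constantCoeff_apply, coeff_expSeries]
  simp

lemma expSeries_add (a b : ℝ) : expSeries (a + b) = expSeries a * expSeries b :=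
  (PowerSeries.exp_mul_exp_eq_exp_add a b).symm

lemma expSeries_zero : expSeries 0 = 1 := by
  ext n
  rcases n with _ | n <;> simp [coeff_expSeries, PowerSeries.coeff_one]

lemma derivative_expSeries (c : ℝ) :
    PowerSeries.derivative ℝ (expSeries c) = c • expSeries c := by
  ext n
  rw [PowerSeries.coeff_derivative, PowerSeries.coeff_smul, coeff_expSeries, coeff_expSeries,
    Nat.factorial_succ, smul_eq_mul]
  push_cast
  field_simp
  ring

/-- Formally `N^{-k-1} = ∫ e^{-Nt} t^k/k! dt`, so raising `N` by one multiplies the integrand by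
`e^{-t}`. On coefficients this is `C(m,k)/m! = 1/(k! (m-k)!)`; the constant term of `p` plays no
part because it is fixed by the shift and dropped by the transform. -/
lemma borelTransform_shiftSeries (p : ℝ⟦X⟧) :
    borelTransform (shiftSeries p) = expSeries (-1) * borelTransform p := by
  ext m
  rw [mul_comm, PowerSeries.coeff_mul, Finset.Nat.sum_antidiagonal_eq_sum_range_succ_mk]
  simp only [borelTransform, shiftSeries, PowerSeries.coeff_mk, coeff_expSeries]
  rw [Finset.sum_range_succ', add_div]
  simp only [shiftCoeff, mul_zero, zero_div, add_zero]
  rw [Finset.sum_div]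
  refine Finset.sum_congr rfl fun k hk => ?_
  have hk' : k ≤ m := by simpa [Nat.lt_succ_iff] using hk
  obtain ⟨j, rfl⟩ := Nat.exists_eq_add_of_le hk'
  have h1 := Nat.choose_mul_factorial_mul_factorial hk'
  rw [Nat.add_sub_cancel_left] at h1
  have h2 : (((k + j).choose k : ℕ) : ℝ) * (k ! : ℝ) * (j ! : ℝ) = ((k + j)! : ℝ) := by
    exact_mod_cast h1
  have h3 : ((-1 : ℝ)) ^ (k + j + k) = (-1) ^ j := by
    rw [show k + j + k = 2 * k + j by ring, pow_add, pow_mul]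
    simp
  rw [h3, ← h2, Nat.add_sub_cancel_left]
  have : ((((k + j).choose k : ℕ) : ℝ)) ≠ 0 := by
    exact_mod_cast (Nat.choose_pos (by omega)).ne'
  field_simp

end

/-! ### The expansion of the summands -/

section

/-- The `m`-th summand of the Landau constants. -/
def landauTerm (m : ℕ) : ℝ := (∏ j ∈ Finset.Icc 1 m, (2 * (j : ℝ) - 1) / (2 * (j : ℝ))) ^ 2

lemma landauTerm_zero : landauTerm 0 = 1 := by simp [landauTerm]

lemma landauTerm_succ (m : ℕ) :
    landauTerm (m + 1) = landauTerm m * ((2 * (m : ℝ) + 1) / (2 * (m : ℝ) + 2)) ^ 2 := by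
  rw [landauTerm, Finset.prod_Icc_succ_top (by omega), mul_pow, landauTerm]
  push_cast
  congr 3 <;> ring

lemma landauTerm_pos (m : ℕ) : 0 < landauTerm m := by
  induction m with
  | zero => simp [landauTerm_zero]
  | succ m ih =>
    rw [landauTerm_succ]
    positivity

lemma landauG_succ (n : ℕ) : landauG (n + 1) = landauG n + landauTerm (n + 1) := by
  rw [landauG, Finset.sum_range_succ]
  rfl

/-- The power series with coefficients `α 1, α 2, …` and vanishing constant term. -/
def coeffSeries (α : ℕ → ℝ) : ℝ⟦X⟧ := mk fun k => if k = 0 then 0 else α k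

lemma IsLandauExpansion.hasExpansion {α : ℕ → ℝ} (hα : IsLandauExpansion α) :
    HasExpansion (fun n : ℕ => Real.pi * landauG n - Real.log (16 * ((n : ℝ) + 1)) -
      Real.eulerMascheroniConstant) (coeffSeries α) := by
  have key : ∀ (l : ℕ) (x : ℝ), ∑ k ∈ Finset.range (l + 1), coeff k (coeffSeries α) * x⁻¹ ^ k =
      ∑ k ∈ Finset.Icc 1 l, α k / x ^ k := by
    intro l x
    rw [Finset.range_eq_Ico, Finset.sum_eq_sum_Ico_succ_bot (by omega)]
    simp only [coeffSeries, PowerSeries.coeff_mk, if_true, zero_mul, zero_add]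
    rw [show Finset.Ico 1 (l + 1) = Finset.Icc 1 l from rfl]
    refine Finset.sum_congr rfl fun k hk => ?_
    rw [if_neg (by have := (Finset.mem_Icc.1 hk).1; omega), inv_pow, div_eq_mul_inv]
  have h1 : ∀ l : ℕ, (fun n : ℕ => (Real.pi * landauG n - Real.log (16 * ((n : ℝ) + 1)) -
      Real.eulerMascheroniConstant) -
      ∑ k ∈ Finset.range (l + 1), coeff k (coeffSeries α) * (((n : ℝ) + 1)⁻¹) ^ k)
      =O[atTop] (fun n : ℕ => (((n : ℝ) + 1)⁻¹) ^ l) := by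
    intro l
    refine ((hα l).isBigO.congr_left fun n => ?_).congr_right fun n => ?_
    · rw [key, truncation]
      ring
    · simp
  -- The hypothesis keeps the `l`-th term and has error `o(N^{-l})`, whereas `HasExpansion` stops
  -- before it; putting the term back costs only `O(N^{-l})`.
  intro l
  have h2 := ((h1 l).add ((isBigO_refl (fun n : ℕ => (((n : ℝ) + 1)⁻¹) ^ l) atTop).const_mul_left
    (coeff l (coeffSeries α))))
  refine h2.congr_left fun n => ?_
  rw [Finset.sum_range_succ]
  ring

/-- The power series of `log (1 + X)`. -/
def logSeries : ℝ⟦X⟧ := mk fun k => (-1) ^ (k + 1) / (k : ℝ)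

lemma hasExpansion_log :
    HasExpansion (fun n : ℕ => Real.log ((n : ℝ) + 2) - Real.log ((n : ℝ) + 1)) logSeries := by
  have h1 : ∀ l : ℕ, (fun n : ℕ => (Real.log ((n : ℝ) + 2) - Real.log ((n : ℝ) + 1)) -
      ∑ k ∈ Finset.range (l + 1), coeff k logSeries * (((n : ℝ) + 1)⁻¹) ^ k)
      =O[atTop] (fun n : ℕ => (((n : ℝ) + 1)⁻¹) ^ (l + 1)) := by
    intro l
    -- For `n ≥ 1` one has `y = 1/(n+1) ≤ 1/2`, so the factor `1/(1 - y)` in the remainder of the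
    -- logarithm is at most 2.
    refine IsBigO.of_bound 2 ?_
    filter_upwards [eventually_ge_atTop 1] with n hn
    have hn' : (1 : ℝ) ≤ n := by exact_mod_cast hn
    set y : ℝ := ((n : ℝ) + 1)⁻¹ with hy
    have hy0 : 0 < y := by positivity
    have hy1 : y ≤ 1 / 2 := by
      rw [hy, one_div]
      exact inv_anti₀ (by norm_num) (by linarith)
    have h2 := Real.abs_log_sub_add_sum_range_le (x := -y)
      (by rw [abs_neg, abs_of_pos hy0]; linarith) l
    have h3 : Real.log (1 - -y) = Real.log ((n : ℝ) + 2) - Real.log ((n : ℝ) + 1) := by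
      rw [← Real.log_div (by positivity) (by positivity)]
      congr 1
      rw [hy]
      field_simp
      ring
    have h4 : ∑ k ∈ Finset.range (l + 1), coeff k logSeries * y ^ k =
        - ∑ i ∈ Finset.range l, (-y) ^ (i + 1) / ((i : ℝ) + 1) := by
      rw [Finset.sum_range_succ', ← Finset.sum_neg_distrib]
      -- At index 0 the formula of `logSeries` reads `-1/0`, which is 0 by convention, as it should
      -- be.
      simp only [logSeries, PowerSeries.coeff_mk, Nat.cast_zero, div_zero, zero_mul, add_zero]
      refine Finset.sum_congr rfl fun i _ => ?_
      rw [neg_pow y]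
      push_cast
      ring
    rw [h3, abs_neg, abs_of_pos hy0] at h2
    rw [h4, sub_neg_eq_add, Real.norm_eq_abs, add_comm, Real.norm_of_nonneg (by positivity)]
    refine h2.trans ?_
    rw [div_le_iff₀ (by linarith)]
    have : 0 < y ^ (l + 1) := by positivity
    nlinarith
  intro l
  rcases l with _ | l
  · refine ((h1 0).trans (HasExpansion.inv_pow_isBigO_of_le (Nat.zero_le _))).congr_left fun n => ?_
    simp [logSeries]
  · exact h1 l

/-- The expansion of `π a_N` in powers of `1 / N`, where `a_N` is the `N`-th summand. -/
def termSeries (α : ℕ → ℝ) : ℝ⟦X⟧ :=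
  logSeries + shiftSeries (coeffSeries α) - coeffSeries α

variable {α : ℕ → ℝ}

lemma hasExpansion_landauTerm (hα : IsLandauExpansion α) :
    HasExpansion (fun n : ℕ => Real.pi * landauTerm (n + 1)) (termSeries α) := by
  have h := hα.hasExpansion
  refine ((hasExpansion_log.add h.shift).sub h).congr' (Eventually.of_forall fun n => ?_)
  simp only
  rw [landauG_succ, Real.log_mul (by norm_num) (by positivity),
    Real.log_mul (by norm_num) (by positivity)]
  push_cast
  rw [show (n : ℝ) + 1 + 1 = n + 2 by ring]
  ring

/-- The relation `(N+1)² a_{N+1} = (N+1/2)² a_N`, divided by `N²`, and uniqueness of expansions. -/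
lemma termSeries_recurrence (hα : IsLandauExpansion α) :
    shiftSeries (termSeries α) + (2 : ℝ) • (PowerSeries.X * shiftSeries (termSeries α)) +
      PowerSeries.X * (PowerSeries.X * shiftSeries (termSeries α)) =
    termSeries α + PowerSeries.X * termSeries α +
      (1 / 4 : ℝ) • (PowerSeries.X * (PowerSeries.X * termSeries α)) := by
  have h := hasExpansion_landauTerm hα
  have hs := h.shift
  refine ((hs.add (hs.inv_mul.smul 2)).add hs.inv_mul.inv_mul).unique
    (((h.add h.inv_mul).add (h.inv_mul.inv_mul.smul (1 / 4))).congr'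
      (Eventually.of_forall fun n => ?_))
  simp only
  rw [landauTerm_succ (n + 1)]
  push_cast
  field_simp
  ring

/-- The Borel transform of the recurrence, differentiated twice to remove both factors `X`. The left
side is `(D + 1)² (e^{-t} φ)`, which collapses to `e^{-t} φ''`. -/
lemma borelTransform_termSeries_ode (hα : IsLandauExpansion α) :
    expSeries (-1) * PowerSeries.derivative ℝ
        (PowerSeries.derivative ℝ (borelTransform (termSeries α))) =
      PowerSeries.derivative ℝ (PowerSeries.derivative ℝ (borelTransform (termSeries α))) +
        PowerSeries.derivative ℝ (borelTransform (termSeries α)) +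
        (1 / 4 : ℝ) • borelTransform (termSeries α) := by
  have h := congrArg (fun p => PowerSeries.derivative ℝ (PowerSeries.derivative ℝ
    (borelTransform p))) (termSeries_recurrence hα)
  simp only [borelTransform_add, borelTransform_smul, map_add, Derivation.map_smul,
    derivative_borelTransform_X_mul, borelTransform_shiftSeries, Derivation.leibniz,
    derivative_expSeries, neg_smul, one_smul, map_neg, smul_eq_mul] at h
  rw [← h]
  simp only [PowerSeries.smul_eq_C_mul, map_ofNat]
  ring

/-- The transform of `log(1 + 1/N)` is `(1 - e^{-t})/t`, and the difference of the shifted and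
unshifted series contributes `e^{-t} - 1`. This is the link from `φ` back to the coefficients `α`.
-/
lemma X_mul_borelTransform_termSeries :
    PowerSeries.X * borelTransform (termSeries α) =
      (1 - expSeries (-1)) * (1 - PowerSeries.X * borelTransform (coeffSeries α)) := by
  have h : PowerSeries.X * borelTransform logSeries = 1 - expSeries (-1) := by
    ext n
    rcases n with _ | n
    · simp [constantCoeff_expSeries]
    · rw [PowerSeries.coeff_succ_X_mul, map_sub, coeff_expSeries, PowerSeries.coeff_one,
        if_neg (by omega), Nat.factorial_succ]
      simp only [borelTransform, logSeries, PowerSeries.coeff_mk]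
      push_cast
      field_simp
      ring
  rw [termSeries, borelTransform_sub, borelTransform_add, borelTransform_shiftSeries, mul_sub,
    mul_add, h]
  ring

end

/-! ### Even power series and the trigonometric series -/

section

/-- The constant `κ` for which `v = κ t ^ 2` when `t = 2 π i √v`. -/
def evenScale : ℝ := -(1 / (4 * Real.pi ^ 2))

lemma evenScale_ne_zero : evenScale ≠ 0 := by
  have := Real.pi_pos
  unfold evenScale
  simp [this.ne']

/-- The substitution `v ↦ κ t ^ 2`, an embedding of power series as even power series. -/
def evenEmbedding : ℝ⟦X⟧ →+* ℝ⟦X⟧ :=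
  (PowerSeries.expand 2 two_ne_zero : ℝ⟦X⟧ →ₐ[ℝ] ℝ⟦X⟧).toRingHom.comp
    (PowerSeries.rescale evenScale)

lemma coeff_evenEmbedding_even (p : ℝ⟦X⟧) (m : ℕ) :
    coeff (2 * m) (evenEmbedding p) = evenScale ^ m * coeff m p := by
  simp only [evenEmbedding, RingHom.comp_apply, AlgHom.toRingHom_eq_coe, RingHom.coe_coe]
  rw [PowerSeries.coeff_expand_mul, PowerSeries.coeff_rescale]

lemma coeff_evenEmbedding_odd (p : ℝ⟦X⟧) (m : ℕ) :
    coeff (2 * m + 1) (evenEmbedding p) = 0 := by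
  simp only [evenEmbedding, RingHom.comp_apply, AlgHom.toRingHom_eq_coe, RingHom.coe_coe]
  exact PowerSeries.coeff_expand_of_not_dvd _ _ _ (by omega)

lemma ext_even_odd {p q : ℝ⟦X⟧} (h0 : ∀ m, coeff (2 * m) p = coeff (2 * m) q)
    (h1 : ∀ m, coeff (2 * m + 1) p = coeff (2 * m + 1) q) : p = q := by
  ext n
  rcases Nat.even_or_odd' n with ⟨m, rfl | rfl⟩
  · exact h0 m
  · exact h1 m

lemma evenEmbedding_injective : Function.Injective evenEmbedding := by
  intro p q h
  ext m
  have := congrArg (coeff (2 * m)) h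
  rw [coeff_evenEmbedding_even, coeff_evenEmbedding_even] at this
  exact mul_left_cancel₀ (pow_ne_zero m evenScale_ne_zero) this

lemma coeff_X_mul_derivative (p : ℝ⟦X⟧) (n : ℕ) :
    coeff n (PowerSeries.X * PowerSeries.derivative ℝ p) = n * coeff n p := by
  rcases n with _ | n
  · simp
  · rw [PowerSeries.coeff_succ_X_mul, PowerSeries.coeff_derivative]
    push_cast
    ring

lemma X_mul_derivative_evenEmbedding (p : ℝ⟦X⟧) :
    PowerSeries.X * PowerSeries.derivative ℝ (evenEmbedding p) =
      2 * evenEmbedding (PowerSeries.X * PowerSeries.derivative ℝ p) := by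
  rw [← map_ofNat (PowerSeries.C (R := ℝ)) 2]
  refine ext_even_odd (fun m => ?_) (fun m => ?_)
  · rw [coeff_X_mul_derivative, PowerSeries.coeff_C_mul, coeff_evenEmbedding_even,
      coeff_evenEmbedding_even, coeff_X_mul_derivative]
    push_cast
    ring
  · rw [coeff_X_mul_derivative, PowerSeries.coeff_C_mul, coeff_evenEmbedding_odd,
      coeff_evenEmbedding_odd]
    ring

lemma X_sq_eq_evenEmbedding :
    (PowerSeries.X : ℝ⟦X⟧) ^ 2 =
      evenEmbedding (PowerSeries.C (-(4 * Real.pi ^ 2)) * PowerSeries.X) := by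
  have := Real.pi_pos
  simp only [evenEmbedding, RingHom.comp_apply, AlgHom.toRingHom_eq_coe, RingHom.coe_coe, map_mul,
    PowerSeries.rescale_X, PowerSeries.expand_X]
  have h : ∀ c : ℝ, PowerSeries.rescale evenScale (PowerSeries.C c) = PowerSeries.C c := by
    intro c
    ext n
    rw [PowerSeries.coeff_rescale, PowerSeries.coeff_C]
    split_ifs with hn <;> simp [hn]
  rw [h, PowerSeries.expand_C, PowerSeries.expand_C, ← mul_assoc, ← map_mul]
  have h2 : -(4 * Real.pi ^ 2) * evenScale = 1 := by
    unfold evenScale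
    field_simp
  rw [h2, map_one, one_mul]

/-! ### Trigonometric series in `v` and their exponential form in `t` -/

/-- The power series in `v` of `sin (π √v) / (π √v)`. -/
def sincSeries : ℝ⟦X⟧ := mk fun m => (-Real.pi ^ 2) ^ m / ((2 * m + 1)! : ℝ)

/-- The power series in `v` of `π √v / sin (π √v)`. -/
def cscSeries : ℝ⟦X⟧ := sincSeries⁻¹

/-- The power series in `v` of `cos (π √v / 2)`. -/
def cosHalfSeries : ℝ⟦X⟧ := mk fun m => (-(Real.pi ^ 2 / 4)) ^ m / ((2 * m)! : ℝ)

/-- The power series in `v` of `sin (π √v / 2) / (π √v / 2)`. -/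
def sincHalfSeries : ℝ⟦X⟧ := PowerSeries.rescale (1 / 4) sincSeries

/-- The power series in `v` of `(π √v / 2) / sin (π √v / 2)`. -/
def cscHalfSeries : ℝ⟦X⟧ := PowerSeries.rescale (1 / 4) cscSeries

lemma coeff_zero_sincSeries : coeff 0 sincSeries = 1 := by simp [sincSeries]

lemma sincSeries_mul_cscSeries : sincSeries * cscSeries = 1 :=
  PowerSeries.mul_inv_cancel _ (by
    rw [← PowerSeries.coeff_zero_eq_constantCoeff_apply, coeff_zero_sincSeries]; norm_num)

lemma sincHalfSeries_mul_cscHalfSeries : sincHalfSeries * cscHalfSeries = 1 := by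
  rw [sincHalfSeries, cscHalfSeries, ← map_mul, sincSeries_mul_cscSeries, map_one]

/-- With `t = 2πi√v` one has `t/2 = iπ√v`, so the cardinal sine becomes `sinh(t/2)/(t/2)`. -/
lemma X_mul_evenEmbedding_sincSeries :
    PowerSeries.X * evenEmbedding sincSeries = expSeries (1 / 2) - expSeries (-(1 / 2)) := by
  have := Real.pi_pos
  refine ext_even_odd (fun m => ?_) (fun m => ?_)
  · rcases m with _ | m
    · simp [constantCoeff_expSeries]
    · rw [show 2 * (m + 1) = 2 * m + 1 + 1 by ring, PowerSeries.coeff_succ_X_mul,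
        coeff_evenEmbedding_odd, map_sub, coeff_expSeries, coeff_expSeries,
        (show Even (2 * m + 1 + 1) from ⟨m + 1, by ring⟩).neg_pow]
      ring
  · rw [PowerSeries.coeff_succ_X_mul, coeff_evenEmbedding_even, map_sub, coeff_expSeries,
      coeff_expSeries, (odd_two_mul_add_one m).neg_pow, sincSeries, PowerSeries.coeff_mk,
      ← mul_div_assoc, ← mul_pow, pow_succ (1 / 2 : ℝ), pow_mul]
    have h : evenScale * -Real.pi ^ 2 = (1 / 2) ^ 2 := by
      unfold evenScale
      field_simp
      ring
    rw [h]
    ring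

lemma X_mul_evenEmbedding_sincHalfSeries :
    PowerSeries.X * evenEmbedding sincHalfSeries =
      2 * (expSeries (1 / 4) - expSeries (-(1 / 4))) := by
  have := Real.pi_pos
  rw [← map_ofNat (PowerSeries.C (R := ℝ)) 2]
  refine ext_even_odd (fun m => ?_) (fun m => ?_)
  · rw [PowerSeries.coeff_C_mul]
    rcases m with _ | m
    · simp [constantCoeff_expSeries]
    · rw [show 2 * (m + 1) = 2 * m + 1 + 1 by ring, PowerSeries.coeff_succ_X_mul,
        coeff_evenEmbedding_odd, map_sub, coeff_expSeries, coeff_expSeries,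
        (show Even (2 * m + 1 + 1) from ⟨m + 1, by ring⟩).neg_pow]
      ring
  · rw [PowerSeries.coeff_C_mul, PowerSeries.coeff_succ_X_mul, coeff_evenEmbedding_even, map_sub,
      coeff_expSeries, coeff_expSeries, (odd_two_mul_add_one m).neg_pow, sincHalfSeries,
      PowerSeries.coeff_rescale, sincSeries, PowerSeries.coeff_mk,
      ← mul_div_assoc, ← mul_div_assoc, ← mul_pow, ← mul_pow, pow_succ (1 / 4 : ℝ), pow_mul]
    have h : evenScale * (1 / 4 * -Real.pi ^ 2) = (1 / 4) ^ 2 := by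
      unfold evenScale
      field_simp
    rw [h]
    ring

lemma two_mul_evenEmbedding_cosHalfSeries :
    2 * evenEmbedding cosHalfSeries = expSeries (1 / 4) + expSeries (-(1 / 4)) := by
  have := Real.pi_pos
  rw [← map_ofNat (PowerSeries.C (R := ℝ)) 2]
  refine ext_even_odd (fun m => ?_) (fun m => ?_)
  · rw [PowerSeries.coeff_C_mul, coeff_evenEmbedding_even, map_add, coeff_expSeries,
      coeff_expSeries, (even_two_mul m).neg_pow, cosHalfSeries, PowerSeries.coeff_mk,
      ← mul_div_assoc, ← mul_pow, pow_mul]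
    have h : evenScale * (-(Real.pi ^ 2 / 4)) = (1 / 4) ^ 2 := by
      unfold evenScale
      field_simp
    rw [h]
    ring
  · rw [PowerSeries.coeff_C_mul, coeff_evenEmbedding_odd, map_add, coeff_expSeries,
      coeff_expSeries, (odd_two_mul_add_one m).neg_pow]
    ring

lemma expSeries_mul_expSeries_neg (c : ℝ) : expSeries c * expSeries (-c) = 1 := by
  rw [← expSeries_add, add_neg_cancel, expSeries_zero]

lemma expSeries_two_mul (c : ℝ) : expSeries (2 * c) = expSeries c ^ 2 := by
  rw [two_mul, expSeries_add, sq]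

lemma two_ne_zero_powerSeries : (2 : ℝ⟦X⟧) ≠ 0 := fun h => by
  have := congrArg PowerSeries.constantCoeff h
  rw [map_ofNat, map_zero] at this
  norm_num at this

/-- The double-angle formula. In the variable `t` it is `a² - b² = (a - b)(a + b)` with `a =
e^{t/4}`, `b = e^{-t/4}`. -/
lemma sincSeries_eq_mul : sincSeries = sincHalfSeries * cosHalfSeries := by
  apply evenEmbedding_injective
  have h2 : expSeries (1 / 2) = expSeries (1 / 4) ^ 2 := by
    rw [← expSeries_two_mul]
    norm_num
  have h3 : expSeries (-(1 / 2)) = expSeries (-(1 / 4)) ^ 2 := by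
    rw [← expSeries_two_mul]
    norm_num
  refine mul_left_cancel₀ (mul_ne_zero two_ne_zero_powerSeries PowerSeries.X_ne_zero) ?_
  rw [map_mul]
  linear_combination 2 * X_mul_evenEmbedding_sincSeries + 2 * h2 - 2 * h3 -
    (expSeries (1 / 4) + expSeries (-(1 / 4))) * X_mul_evenEmbedding_sincHalfSeries -
    PowerSeries.X * evenEmbedding sincHalfSeries * two_mul_evenEmbedding_cosHalfSeries

lemma cscHalfSeries_eq_mul : cscHalfSeries = cosHalfSeries * cscSeries := by
  linear_combination -cscHalfSeries * sincSeries_mul_cscSeries +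
    cscHalfSeries * cscSeries * sincSeries_eq_mul +
    cosHalfSeries * cscSeries * sincHalfSeries_mul_cscHalfSeries

/-! ### Self-adjoint form of the differential equation -/

/-- The Legendre type power series `e ^ (t / 4) φ (t)`, where `φ` is the Borel transform of the
expansion of the summands. -/
def symmetricSeries (α : ℕ → ℝ) : ℝ⟦X⟧ := expSeries (1 / 4) * borelTransform (termSeries α)

variable {α : ℕ → ℝ}

lemma borelTransform_termSeries_eq :
    borelTransform (termSeries α) = expSeries (-(1 / 4)) * symmetricSeries α := by
  rw [symmetricSeries, ← mul_assoc, mul_comm (expSeries (-(1 / 4))), expSeries_mul_expSeries_neg,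
    one_mul]

lemma four_mul_derivative_expSeries :
    4 * PowerSeries.derivative ℝ (expSeries (-(1 / 4))) = -expSeries (-(1 / 4)) := by
  rw [derivative_expSeries, ← map_ofNat (PowerSeries.C (R := ℝ)) 4, ← PowerSeries.smul_eq_C_mul,
    smul_smul]
  norm_num

lemma derivative_four_mul (p : ℝ⟦X⟧) :
    PowerSeries.derivative ℝ (4 * p) = 4 * PowerSeries.derivative ℝ p := by
  rw [← map_ofNat (PowerSeries.C (R := ℝ)) 4, ← PowerSeries.smul_eq_C_mul, Derivation.map_smul,
    PowerSeries.smul_eq_C_mul]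

/-- Multiplying the equation of `φ = e^{-t/4} ψ` by `e^{3t/4}` balances the exponentials into
`e^{±t/2}` and leaves a self-adjoint equation: Legendre's equation in `cosh(t/2)` with `ν(ν+1) =
-1/4`. -/
lemma symmetricSeries_ode (hα : IsLandauExpansion α) :
    16 * PowerSeries.derivative ℝ ((expSeries (1 / 2) - expSeries (-(1 / 2))) *
      PowerSeries.derivative ℝ (symmetricSeries α)) =
    -((expSeries (1 / 2) - expSeries (-(1 / 2))) * symmetricSeries α) := by
  have h := borelTransform_termSeries_ode hα
  have h4 : (4 : ℝ⟦X⟧) * ((1 / 4 : ℝ) • borelTransform (termSeries α)) =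
      borelTransform (termSeries α) := by
    rw [← map_ofNat (PowerSeries.C (R := ℝ)) 4, ← PowerSeries.smul_eq_C_mul, smul_smul]
    norm_num
  rw [borelTransform_termSeries_eq] at h h4
  have hb := four_mul_derivative_expSeries
  have ha2 : 2 * PowerSeries.derivative ℝ (expSeries (1 / 2)) = expSeries (1 / 2) := by
    rw [derivative_expSeries, ← map_ofNat (PowerSeries.C (R := ℝ)) 2, ← PowerSeries.smul_eq_C_mul,
      smul_smul]
    norm_num
  have hb2 : 2 * PowerSeries.derivative ℝ (expSeries (-(1 / 2))) = -expSeries (-(1 / 2)) := by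
    rw [derivative_expSeries, ← map_ofNat (PowerSeries.C (R := ℝ)) 2, ← PowerSeries.smul_eq_C_mul,
      smul_smul]
    norm_num
  have h1 : expSeries (-1) * expSeries (-(1 / 4)) * expSeries (3 / 4) = expSeries (-(1 / 2)) := by
    rw [← expSeries_add, ← expSeries_add]
    norm_num
  have h2 : expSeries (-(1 / 4)) * expSeries (3 / 4) = expSeries (1 / 2) := by
    rw [← expSeries_add]
    norm_num
  set ψ := symmetricSeries α
  set b := expSeries (-(1 / 4))
  set a := expSeries (3 / 4)
  set e := expSeries (-1)
  have hd1 : 4 * PowerSeries.derivative ℝ (b * ψ) = b * (4 * PowerSeries.derivative ℝ ψ - ψ) := by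
    rw [Derivation.leibniz, smul_eq_mul, smul_eq_mul]
    linear_combination ψ * hb
  have hd2 : 16 * PowerSeries.derivative ℝ (PowerSeries.derivative ℝ (b * ψ)) =
      b * (16 * PowerSeries.derivative ℝ (PowerSeries.derivative ℝ ψ) -
        8 * PowerSeries.derivative ℝ ψ + ψ) := by
    have h5 := congrArg (PowerSeries.derivative ℝ) hd1
    rw [derivative_four_mul, Derivation.leibniz _ b (4 * _ - _), map_sub, derivative_four_mul,
      smul_eq_mul,
      smul_eq_mul] at h5
    linear_combination 4 * h5 + (4 * PowerSeries.derivative ℝ ψ - ψ) * hb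
  rw [Derivation.leibniz, map_sub, smul_eq_mul, smul_eq_mul]
  set ψ₁ := PowerSeries.derivative ℝ ψ
  set ψ₂ := PowerSeries.derivative ℝ ψ₁
  linear_combination 8 * ψ₁ * ha2 - 8 * ψ₁ * hb2 - 16 * a * h + a * e * hd2 - a * hd2 -
    4 * a * hd1 - 4 * a * h4 + (16 * ψ₂ - 8 * ψ₁ + ψ) * h1 - (16 * ψ₂ + 8 * ψ₁ + ψ) * h2

end

/-! ### The Legendre series -/

section

variable {α : ℕ → ℝ}

lemma symmetricSeries_euler_ode (hα : IsLandauExpansion α) :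
    16 * (PowerSeries.X * PowerSeries.derivative ℝ (evenEmbedding sincSeries *
      (PowerSeries.X * PowerSeries.derivative ℝ (symmetricSeries α)))) =
    -(PowerSeries.X * (PowerSeries.X * (evenEmbedding sincSeries * symmetricSeries α))) := by
  have h := symmetricSeries_ode hα
  rw [← X_mul_evenEmbedding_sincSeries] at h
  have h2 : evenEmbedding sincSeries * (PowerSeries.X *
      PowerSeries.derivative ℝ (symmetricSeries α)) = PowerSeries.X * evenEmbedding sincSeries *
      PowerSeries.derivative ℝ (symmetricSeries α) := by ring
  rw [h2]
  linear_combination PowerSeries.X * h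

/-- In `ϑ(Sϑψ) = -t² S ψ/16`, now with `ϑ = t d/dt`, the series `S` is even, so the coefficient of
index `j` enters with the factor `j²` and is tied only to earlier ones of the same parity. For odd
`j` the factor never vanishes and there is nothing to start the recursion. -/
lemma coeff_odd_symmetricSeries (hα : IsLandauExpansion α) (m : ℕ) :
    coeff (2 * m + 1) (symmetricSeries α) = 0 := by
  induction m using Nat.strong_induction_on with
  | _ m ih =>
    have h := congrArg (coeff (2 * m + 1)) (symmetricSeries_euler_ode hα)
    rw [← map_ofNat (PowerSeries.C (R := ℝ)) 16, PowerSeries.coeff_C_mul, coeff_X_mul_derivative,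
      map_neg, PowerSeries.coeff_succ_X_mul, PowerSeries.coeff_mul,
      Finset.sum_eq_single ((0, 2 * m + 1) : ℕ × ℕ)] at h
    · have h0 : coeff 0 (evenEmbedding sincSeries) = 1 := by
        have := coeff_evenEmbedding_even sincSeries 0
        simpa [-PowerSeries.coeff_zero_eq_constantCoeff, coeff_zero_sincSeries] using this
      have h1 : coeff (2 * m)
          (PowerSeries.X * (evenEmbedding sincSeries * symmetricSeries α)) = 0 := by
        rcases m with _ | m
        · simp
        · rw [show 2 * (m + 1) = (2 * m + 1) + 1 by ring, PowerSeries.coeff_succ_X_mul,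
            PowerSeries.coeff_mul]
          refine Finset.sum_eq_zero fun x hx => ?_
          have hx' := Finset.HasAntidiagonal.mem_antidiagonal.1 hx
          rcases Nat.even_or_odd' x.1 with ⟨i, hi | hi⟩
          · rw [show x.2 = 2 * (m - i) + 1 by omega, ih (m - i) (by omega), mul_zero]
          · rw [hi, coeff_evenEmbedding_odd, zero_mul]
      rw [h0, h1, coeff_X_mul_derivative, neg_zero, one_mul] at h
      have h2 : (0 : ℝ) < ((2 * m + 1 : ℕ) : ℝ) := by positivity
      have h3 : (OfNat.ofNat 16 : ℝ) * (((2 * m + 1 : ℕ) : ℝ) * ((2 * m + 1 : ℕ) : ℝ)) ≠ 0 :=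
        mul_ne_zero (by norm_num) (mul_pos h2 h2).ne'
      refine (mul_eq_zero.1 ?_).resolve_left h3
      rw [← h]
      ring
    · intro x hx hne
      have hx' := Finset.HasAntidiagonal.mem_antidiagonal.1 hx
      rcases Nat.even_or_odd' x.1 with ⟨i, hi | hi⟩
      · have hi0 : i ≠ 0 := by
          rintro rfl
          exact hne (Prod.ext (by simpa using hi) (by simp; omega))
        rw [show x.2 = 2 * (m - i) + 1 by omega, coeff_X_mul_derivative, ih (m - i) (by omega)]
        simp
      · rw [hi, coeff_evenEmbedding_odd, zero_mul]
    · intro hne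
      exact absurd (Finset.HasAntidiagonal.mem_antidiagonal.2 (by simp)) hne

/-- The Taylor series in `v` of the Legendre function `P_{-1/2} (cos (π √v))`. -/
def legendreSeries (α : ℕ → ℝ) : ℝ⟦X⟧ :=
  mk fun m => coeff (2 * m) (symmetricSeries α) / evenScale ^ m

lemma evenEmbedding_legendreSeries (hα : IsLandauExpansion α) :
    evenEmbedding (legendreSeries α) = symmetricSeries α := by
  refine ext_even_odd (fun m => ?_) (fun m => ?_)
  · rw [coeff_evenEmbedding_even, legendreSeries, PowerSeries.coeff_mk]
    exact mul_div_cancel₀ _ (pow_ne_zero m evenScale_ne_zero)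
  · rw [coeff_evenEmbedding_odd, coeff_odd_symmetricSeries hα]

lemma legendreSeries_ode (hα : IsLandauExpansion α) :
    PowerSeries.X * PowerSeries.derivative ℝ (sincSeries *
      (PowerSeries.X * PowerSeries.derivative ℝ (legendreSeries α))) =
    PowerSeries.C (Real.pi ^ 2 / 16) * (PowerSeries.X * (sincSeries * legendreSeries α)) := by
  have h := symmetricSeries_euler_ode hα
  rw [← evenEmbedding_legendreSeries hα, X_mul_derivative_evenEmbedding] at h
  have h2 : ∀ p : ℝ⟦X⟧, evenEmbedding sincSeries * (2 * evenEmbedding p) =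
      evenEmbedding (2 * (sincSeries * p)) := by
    intro p
    rw [map_mul, map_ofNat, map_mul]
    ring
  rw [h2, X_mul_derivative_evenEmbedding] at h
  have h3 : ∀ p : ℝ⟦X⟧, PowerSeries.derivative ℝ (2 * p) = 2 * PowerSeries.derivative ℝ p := by
    intro p
    rw [← map_ofNat (PowerSeries.C (R := ℝ)) 2, ← PowerSeries.smul_eq_C_mul, Derivation.map_smul,
      PowerSeries.smul_eq_C_mul]
  rw [h3, ← mul_assoc PowerSeries.X PowerSeries.X, ← sq, X_sq_eq_evenEmbedding, ← map_mul,
    ← map_mul, ← map_neg, ← map_ofNat evenEmbedding 2, ← map_ofNat evenEmbedding 16, ← map_mul,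
    ← map_mul] at h
  have h4 := evenEmbedding_injective h
  rw [map_ofNat] at h4
  -- Here 64 is the 16 of the equation times a factor 2 from each of the two operators `t d/dt = 2 v
  -- d/dv`; with `t² = -4π² v` the constant becomes `4π²/64 = π²/16`.
  have h5 : PowerSeries.C (1 / 64) * (64 : ℝ⟦X⟧) = 1 := by
    rw [← map_ofNat (PowerSeries.C (R := ℝ)) 64, ← map_mul]
    norm_num
  have h6 : PowerSeries.C (1 / 64) * PowerSeries.C (-(4 * Real.pi ^ 2)) =
      -PowerSeries.C (Real.pi ^ 2 / 16) := by
    rw [← map_mul, ← map_neg]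
    congr 1
    ring
  linear_combination PowerSeries.C (1 / 64) * h4 -
    PowerSeries.X * PowerSeries.derivative ℝ (sincSeries *
      (PowerSeries.X * PowerSeries.derivative ℝ (legendreSeries α))) * h5 -
    PowerSeries.X * (sincSeries * legendreSeries α) * h6

lemma expSeries_mul_symmetricSeries :
    expSeries (1 / 4) * symmetricSeries α = evenEmbedding sincSeries *
      (1 - PowerSeries.X * borelTransform (coeffSeries α)) := by
  have h := X_mul_borelTransform_termSeries (α := α)
  rw [borelTransform_termSeries_eq] at h
  have h1 : expSeries (1 / 2) * expSeries (-(1 / 4)) = expSeries (1 / 4) := by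
    rw [← expSeries_add]
    norm_num
  have h2 : expSeries (1 / 2) * expSeries (-1) = expSeries (-(1 / 2)) := by
    rw [← expSeries_add]
    norm_num
  refine mul_left_cancel₀ (PowerSeries.X_ne_zero (R := ℝ)) ?_
  rw [← mul_assoc PowerSeries.X (evenEmbedding _), X_mul_evenEmbedding_sincSeries, ← h1, ← h2]
  linear_combination expSeries (1 / 2) * h

lemma coeff_zero_legendreSeries : coeff 0 (legendreSeries α) = 1 := by
  have h := congrArg PowerSeries.constantCoeff (expSeries_mul_symmetricSeries (α := α))
  have h0 : PowerSeries.constantCoeff (evenEmbedding sincSeries) = 1 := by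
    have := coeff_evenEmbedding_even sincSeries 0
    rw [coeff_zero_sincSeries] at this
    simpa using this
  simp only [map_mul, constantCoeff_expSeries, h0, map_sub, map_one, PowerSeries.constantCoeff_X,
    zero_mul, one_mul, sub_zero] at h
  simp [legendreSeries, h]

/-- Write `e^{t/4} = cosh(t/4) + sinh(t/4)` and divide by `S`. By the double-angle formula the
`cosh` part is the half-angle cosecant, while `sinh(t/4)` is `t/4` times the half-angle cardinal
sine. The two summands are even and odd in `t`, so they carry the `α` of even and odd index
respectively. -/
lemma one_sub_X_mul_borelTransform (hα : IsLandauExpansion α) :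
    4 * (1 - PowerSeries.X * borelTransform (coeffSeries α)) =
      4 * evenEmbedding (cscHalfSeries * legendreSeries α) +
        PowerSeries.X * evenEmbedding (sincHalfSeries * (cscSeries * legendreSeries α)) := by
  have h := expSeries_mul_symmetricSeries (α := α)
  rw [← evenEmbedding_legendreSeries hα] at h
  have h1 := congrArg evenEmbedding sincSeries_mul_cscSeries
  rw [map_mul, map_one] at h1
  have h2 := two_mul_evenEmbedding_cosHalfSeries
  have h3 := X_mul_evenEmbedding_sincHalfSeries
  rw [cscHalfSeries_eq_mul]
  simp only [map_mul]
  linear_combination -4 * evenEmbedding cscSeries * h - 4 *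
    (1 - PowerSeries.X * borelTransform (coeffSeries α)) * h1 -
    2 * evenEmbedding cscSeries * evenEmbedding (legendreSeries α) * h2 -
    evenEmbedding cscSeries * evenEmbedding (legendreSeries α) * h3

lemma coeff_one_sub_X_mul_borelTransform (k : ℕ) :
    coeff (k + 1) (1 - PowerSeries.X * borelTransform (coeffSeries α)) =
      -(α (k + 1) / (k ! : ℝ)) := by
  rw [map_sub, PowerSeries.coeff_one, if_neg (by omega), PowerSeries.coeff_succ_X_mul]
  simp [borelTransform, coeffSeries]

lemma evenScale_pow (k : ℕ) : evenScale ^ k = (-1) ^ k / (2 * Real.pi) ^ (2 * k) := by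
  rw [pow_mul, ← div_pow]
  congr 1
  unfold evenScale
  ring

lemma expansion_coeff_even (hα : IsLandauExpansion α) {k : ℕ} (hk : 1 ≤ k) :
    α (2 * k) = (-1) ^ (k + 1) * (((2 * k - 1)! : ℝ) / (2 * Real.pi) ^ (2 * k)) *
      coeff k (cscHalfSeries * legendreSeries α) := by
  have h := congrArg (coeff (2 * k)) (one_sub_X_mul_borelTransform hα)
  obtain ⟨k, rfl⟩ := Nat.exists_eq_add_of_le' hk
  rw [← map_ofNat (PowerSeries.C (R := ℝ)) 4, map_add, PowerSeries.coeff_C_mul,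
    PowerSeries.coeff_C_mul, coeff_evenEmbedding_even,
    show 2 * (k + 1) = (2 * k + 1) + 1 by ring, coeff_one_sub_X_mul_borelTransform,
    PowerSeries.coeff_succ_X_mul, coeff_evenEmbedding_odd, add_zero] at h
  have h1 := mul_left_cancel₀ (by norm_num : (OfNat.ofNat 4 : ℝ) ≠ 0) h
  rw [show 2 * (k + 1) - 1 = 2 * k + 1 by omega, show 2 * (k + 1) = (2 * k + 1) + 1 by ring]
  have hf : ((2 * k + 1)! : ℝ) ≠ 0 := by positivity
  have h2 : α (2 * k + 1 + 1) = -((2 * k + 1)! : ℝ) *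
      (evenScale ^ (k + 1) * coeff (k + 1) (cscHalfSeries * legendreSeries α)) := by
    rw [← h1]
    field_simp
  rw [h2, evenScale_pow, show 2 * (k + 1) = (2 * k + 1) + 1 by ring]
  ring

lemma expansion_coeff_odd (hα : IsLandauExpansion α) (k : ℕ) :
    α (2 * k + 1) = (-1) ^ (k + 1) * (((2 * k)! : ℝ) / (2 * Real.pi) ^ (2 * k)) *
      (coeff k (sincHalfSeries * (cscSeries * legendreSeries α)) / 4) := by
  have h := congrArg (coeff (2 * k + 1)) (one_sub_X_mul_borelTransform hα)
  rw [← map_ofNat (PowerSeries.C (R := ℝ)) 4, map_add, PowerSeries.coeff_C_mul,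
    PowerSeries.coeff_C_mul, coeff_evenEmbedding_odd, coeff_one_sub_X_mul_borelTransform,
    PowerSeries.coeff_succ_X_mul, coeff_evenEmbedding_even, mul_zero, zero_add] at h
  have hf : ((2 * k)! : ℝ) ≠ 0 := by positivity
  have h2 : α (2 * k + 1) = -((2 * k)! : ℝ) * (evenScale ^ k *
      coeff k (sincHalfSeries * (cscSeries * legendreSeries α))) / OfNat.ofNat 4 := by
    rw [← h]
    have : (OfNat.ofNat 4 : ℝ) = 4 := rfl
    rw [this]
    field_simp
  have : (OfNat.ofNat 4 : ℝ) = 4 := rfl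
  rw [h2, evenScale_pow, this]
  ring

end

/-! ### The coefficients of the cosecant -/

/-- With `a = e^{t/2}`: `t/(a - 1) - t/(a² - 1) = t/(a - a⁻¹) = (t/2)/sinh(t/2)`. -/
lemma evenEmbedding_cscSeries :
    evenEmbedding cscSeries = 2 * PowerSeries.rescale (1 / 2) (bernoulliPowerSeries ℝ) -
      bernoulliPowerSeries ℝ := by
  have h1 : PowerSeries.exp ℝ = expSeries 1 := by simp [expSeries]
  have hB := bernoulliPowerSeries_mul_exp_sub_one ℝ
  have hH := congrArg (PowerSeries.rescale (1 / 2 : ℝ)) hB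
  rw [map_mul, map_sub, map_one, PowerSeries.rescale_X] at hH
  change _ * (expSeries (1 / 2) - 1) = _ at hH
  rw [h1] at hB
  have h2 : (2 : ℝ⟦X⟧) * PowerSeries.C (1 / 2) = 1 := by
    rw [← map_ofNat (PowerSeries.C (R := ℝ)) 2, ← map_mul]
    norm_num
  have h3 : expSeries 1 = expSeries (1 / 2) ^ 2 := by
    rw [← expSeries_two_mul]
    norm_num
  have h4 := expSeries_mul_expSeries_neg (1 / 2)
  have hZ := X_mul_evenEmbedding_sincSeries
  have hS := congrArg evenEmbedding sincSeries_mul_cscSeries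
  rw [map_mul, map_one] at hS
  set B := bernoulliPowerSeries ℝ
  set H := PowerSeries.rescale (1 / 2 : ℝ) B
  set a := expSeries (1 / 2)
  set b := expSeries (-(1 / 2))
  rw [h3] at hB
  have h5 : (2 * H - B) * evenEmbedding sincSeries = 1 := by
    refine mul_left_cancel₀ (PowerSeries.X_ne_zero (R := ℝ)) ?_
    have h6 : (2 * H - B) * (a ^ 2 - 1) = PowerSeries.X * a := by
      linear_combination 2 * (a + 1) * hH - hB + PowerSeries.X * (a + 1) * h2
    linear_combination (2 * H - B) * hZ + b * h6 + (PowerSeries.X - (2 * H - B) * a) * h4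
  linear_combination (2 * H - B) * hS - evenEmbedding cscSeries * h5

/-- For `n ≥ 2`, `n^{-2m} ≤ 4 · 4^{-m} n^{-2}`, so the tail is compared with `ζ(2) = π²/6 ≤ 2`. The
term `n = 0` is `1/0 = 0`. -/
lemma abs_tsum_inv_even_pow_sub_one_le {m : ℕ} (hm : 1 ≤ m) {s : ℝ}
    (hs : HasSum (fun n : ℕ => 1 / (n : ℝ) ^ (2 * m)) s) : |s - 1| ≤ 8 * (1 / 4) ^ m := by
  have h1 : HasSum (fun n : ℕ => if n = 1 then (1 : ℝ) else 0) 1 := hasSum_ite_eq 1 1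
  have h2 := hs.sub h1
  have h3 := hasSum_zeta_two.mul_left (4 * (1 / 4 : ℝ) ^ m)
  have hnn : ∀ n : ℕ, 0 ≤ 1 / (n : ℝ) ^ (2 * m) - (if n = 1 then (1 : ℝ) else 0) := by
    intro n
    split_ifs with hn
    · simp [hn]
    · simp only [sub_zero]
      positivity
  have h4 : s - 1 ≤ 4 * (1 / 4) ^ m * (Real.pi ^ 2 / 6) := by
    refine hasSum_le (fun n => ?_) h2 h3
    split_ifs with hn
    · simp only [hn, Nat.cast_one, one_pow, div_one, sub_self]
      positivity
    · rw [sub_zero]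
      rcases Nat.eq_zero_or_pos n with rfl | hpos
      · simp [show m ≠ 0 by omega]
      · have hn2 : (2 : ℝ) ≤ n := by exact_mod_cast (by omega : 2 ≤ n)
        obtain ⟨k, rfl⟩ := Nat.exists_eq_add_of_le' hm
        have h5 : (4 : ℝ) ^ k ≤ (n : ℝ) ^ (2 * k) := by
          rw [pow_mul]
          exact pow_le_pow_left₀ (by norm_num) (by nlinarith) k
        have h6 : 4 * (1 / 4 : ℝ) ^ (k + 1) * (1 / (n : ℝ) ^ 2) = 1 / (4 ^ k * (n : ℝ) ^ 2) := by
          rw [pow_succ, one_div_pow]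
          field_simp
        rw [h6, show 2 * (k + 1) = 2 * k + 2 by ring, pow_add]
        gcongr
  have h7 : Real.pi ^ 2 / 6 ≤ 2 := by nlinarith [Real.pi_lt_d2, Real.pi_pos]
  have h8 : 0 ≤ s - 1 := h2.nonneg hnn
  rw [abs_of_nonneg h8]
  have h9 : (0 : ℝ) < (1 / 4) ^ m := by positivity
  nlinarith

/-- The function `π√v/sin(π√v)` has principal part `2/(1 - v)` at `v = 1` and its next pole at `v =
4`. For `m ≥ 1` the Bernoulli numbers and Euler's formula give its coefficient exactly as `2 (1 -
2·4^{-m}) ζ(2m)`; the constant 100 is generous and also covers `m = 0`. -/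
lemma abs_coeff_cscSeries_sub_two_le (m : ℕ) :
    |coeff m cscSeries - 2| ≤ 100 * (1 / 4) ^ m := by
  rcases Nat.eq_zero_or_pos m with rfl | hm
  · have h := congrArg PowerSeries.constantCoeff sincSeries_mul_cscSeries
    rw [map_mul, ← PowerSeries.coeff_zero_eq_constantCoeff_apply, coeff_zero_sincSeries,
      ← PowerSeries.coeff_zero_eq_constantCoeff_apply, one_mul, map_one] at h
    rw [h]
    norm_num
  · have h := congrArg (coeff (2 * m)) evenEmbedding_cscSeries
    rw [coeff_evenEmbedding_even, ← map_ofNat (PowerSeries.C (R := ℝ)) 2, map_sub,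
      PowerSeries.coeff_C_mul, PowerSeries.coeff_rescale, bernoulliPowerSeries,
      PowerSeries.coeff_mk, evenScale_pow] at h
    have hz := hasSum_zeta_nat (k := m) (by omega)
    set s : ℝ := (-1 : ℝ) ^ (m + 1) * (2 : ℝ) ^ (2 * m - 1) * Real.pi ^ (2 * m) *
      bernoulli (2 * m) / (2 * m)! with hs
    have hb := abs_tsum_inv_even_pow_sub_one_le hm hz
    have hpi := Real.pi_pos
    have h2 : (2 : ℝ) ^ (2 * m) = 2 * 2 ^ (2 * m - 1) := by
      rw [← pow_succ']
      congr 1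
      omega
    have hsq : ((-1 : ℝ) ^ m) * (-1) ^ m = 1 := by
      rw [← mul_pow]
      norm_num
    have h3 : coeff m cscSeries = 2 * (1 - 2 * (1 / 4) ^ m) * s := by
      have h4 : (1 / 2 : ℝ) ^ (2 * m) = (1 / 4) ^ m := by
        rw [pow_mul]
        norm_num
      have h5 : coeff m cscSeries = (-1) ^ m * (2 * Real.pi) ^ (2 * m) *
          ((-1) ^ m / (2 * Real.pi) ^ (2 * m) * coeff m cscSeries) := by
        field_simp
        linear_combination -(coeff m cscSeries) * hsq
      rw [h5, h, h4, hs, mul_pow, h2, pow_succ]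
      have : (OfNat.ofNat 2 : ℝ) = 2 := rfl
      rw [this, eq_ratCast]
      push_cast
      ring
    have h9 : (0 : ℝ) < (1 / 4) ^ m := by positivity
    have h10 : (1 / 4 : ℝ) ^ m ≤ 1 := pow_le_one₀ (by norm_num) (by norm_num)
    rw [h3, show 2 * (1 - 2 * (1 / 4) ^ m) * s - 2 =
      2 * (s - 1) - 4 * (1 / 4) ^ m * (s - 1) - 4 * (1 / 4) ^ m by ring]
    rw [abs_le] at hb ⊢
    constructor <;> nlinarith

/-! ### Convolution estimates -/

/-- A submultiplicative weight distributes over the convolution, as in `ℓ¹ * ℓ^∞ ⊆ ℓ^∞`. The bound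
on `q` is asked only up to index `n`, so that it can be used inside a strong induction. -/
lemma abs_coeff_mul_le_of_weight {p q : ℝ⟦X⟧} {w : ℕ → ℝ} (hw : ∀ n, 0 ≤ w n)
    (hmul : ∀ i j, w (i + j) ≤ w i * w j) (hp : Summable fun i => |coeff i p| * w i) {B : ℝ} {n : ℕ}
    (hq : ∀ j ≤ n, |coeff j q| * w j ≤ B) :
    |coeff n (p * q)| * w n ≤ (∑' i, |coeff i p| * w i) * B := by
  have hB : 0 ≤ B := (mul_nonneg (abs_nonneg _) (hw 0)).trans (hq 0 (Nat.zero_le n))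
  rw [PowerSeries.coeff_mul, Finset.Nat.sum_antidiagonal_eq_sum_range_succ_mk]
  calc |∑ k ∈ Finset.range n.succ, coeff k p * coeff (n - k) q| * w n
      ≤ (∑ k ∈ Finset.range n.succ, |coeff k p * coeff (n - k) q|) * w n :=
        mul_le_mul_of_nonneg_right (Finset.abs_sum_le_sum_abs _ _) (hw n)
    _ = ∑ k ∈ Finset.range n.succ, |coeff k p * coeff (n - k) q| * w n := Finset.sum_mul _ _ _
    _ ≤ ∑ k ∈ Finset.range n.succ, |coeff k p| * w k * B := by
        refine Finset.sum_le_sum fun k hk => ?_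
        have hk' : k ≤ n := by simpa [Nat.lt_succ_iff] using hk
        have h1 := hmul k (n - k)
        rw [Nat.add_sub_of_le hk'] at h1
        calc |coeff k p * coeff (n - k) q| * w n
            ≤ |coeff k p * coeff (n - k) q| * (w k * w (n - k)) :=
              mul_le_mul_of_nonneg_left h1 (abs_nonneg _)
          _ = |coeff k p| * w k * (|coeff (n - k) q| * w (n - k)) := by rw [abs_mul]; ring
          _ ≤ |coeff k p| * w k * B :=
              mul_le_mul_of_nonneg_left (hq _ (Nat.sub_le n k)) (mul_nonneg (abs_nonneg _) (hw k))
    _ = (∑ k ∈ Finset.range n.succ, |coeff k p| * w k) * B := (Finset.sum_mul _ _ _).symm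
    _ ≤ _ := mul_le_mul_of_nonneg_right
        (hp.sum_le_tsum _ fun i _ => mul_nonneg (abs_nonneg _) (hw i)) hB

lemma succ_pow_submultiplicative (r i j : ℕ) :
    (((i + j : ℕ) : ℝ) + 1) ^ r ≤ ((i : ℝ) + 1) ^ r * ((j : ℝ) + 1) ^ r := by
  rw [← mul_pow]
  refine pow_le_pow_left₀ (by positivity) ?_ r
  push_cast
  nlinarith [mul_nonneg (i.cast_nonneg (α := ℝ)) (j.cast_nonneg (α := ℝ))]

lemma sqrt_succ_submultiplicative (i j : ℕ) :
    √(((i + j : ℕ) : ℝ) + 1) ≤ √((i : ℝ) + 1) * √((j : ℝ) + 1) := by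
  rw [← Real.sqrt_mul (by positivity)]
  refine Real.sqrt_le_sqrt ?_
  push_cast
  nlinarith [mul_nonneg (i.cast_nonneg (α := ℝ)) (j.cast_nonneg (α := ℝ))]

/-- The coefficients of `p` are `O(4 ^ (-m))`. -/
def GeometricDecay (p : ℝ⟦X⟧) : Prop := ∃ K : ℝ, ∀ m, |coeff m p| ≤ K * (1 / 4) ^ m

lemma GeometricDecay.summable {p : ℝ⟦X⟧} (h : GeometricDecay p) (r : ℕ) :
    Summable fun i : ℕ => |coeff i p| * ((i : ℝ) + 1) ^ r := by
  obtain ⟨K, hK⟩ := h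
  have h1 : Summable fun i : ℕ => ((i : ℝ)) ^ r * (1 / 4 : ℝ) ^ i :=
    summable_pow_mul_geometric_of_norm_lt_one r (by norm_num)
  have h2 := ((summable_nat_add_iff 1).2 h1).mul_left (4 * K)
  refine Summable.of_nonneg_of_le (fun i => by positivity) (fun i => ?_) h2
  calc |coeff i p| * ((i : ℝ) + 1) ^ r ≤ K * (1 / 4) ^ i * ((i : ℝ) + 1) ^ r :=
        mul_le_mul_of_nonneg_right (hK i) (by positivity)
    _ = _ := by
        push_cast
        ring

lemma GeometricDecay.summable_sqrt {p : ℝ⟦X⟧} (h : GeometricDecay p) :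
    Summable fun i : ℕ => |coeff i p| * √((i : ℝ) + 1) := by
  refine Summable.of_nonneg_of_le (fun i => by positivity) (fun i => ?_) (h.summable 1)
  refine mul_le_mul_of_nonneg_left ?_ (abs_nonneg _)
  rw [pow_one]
  exact Real.sqrt_le_iff.2 ⟨by positivity, by nlinarith [i.cast_nonneg (α := ℝ)]⟩

lemma GeometricDecay.abs_coeff_mul_le {p q : ℝ⟦X⟧} (h : GeometricDecay p) (r : ℕ) {B : ℝ}
    (hq : ∀ j, |coeff j q| * ((j : ℝ) + 1) ^ r ≤ B) :
    ∃ K, ∀ n, |coeff n (p * q)| * ((n : ℝ) + 1) ^ r ≤ K :=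
  ⟨_, fun _ => abs_coeff_mul_le_of_weight (w := fun n => ((n : ℝ) + 1) ^ r)
    (fun n => by positivity) (succ_pow_submultiplicative r) (h.summable r) fun j _ => hq j⟩

lemma geometricDecay_sincSeries : GeometricDecay sincSeries := by
  -- From `π² ≤ 10`, and `10^m/m! = 4^{-m} · 40^m/m! ≤ 4^{-m} e^{40}`.
  refine ⟨Real.exp 40, fun m => ?_⟩
  have h1 := Real.pow_div_factorial_le_exp (x := 40) (by norm_num) m
  have h2 : (m ! : ℝ) ≤ ((2 * m + 1)! : ℝ) := by
    exact_mod_cast Nat.factorial_le (by omega)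
  have h3 : Real.pi ^ 2 ≤ 10 := by nlinarith [Real.pi_lt_d2, Real.pi_pos]
  rw [sincSeries, PowerSeries.coeff_mk, abs_div, abs_pow, abs_neg,
    abs_of_nonneg (sq_nonneg Real.pi),
    abs_of_pos (by positivity)]
  calc (Real.pi ^ 2) ^ m / ((2 * m + 1)! : ℝ) ≤ 10 ^ m / (m ! : ℝ) := by gcongr
    _ = 40 ^ m / (m ! : ℝ) * (1 / 4) ^ m := by
        rw [show (40 : ℝ) = 10 * 4 by norm_num, mul_pow, one_div_pow]
        field_simp
    _ ≤ _ := by gcongr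

lemma abs_coeff_cscSeries_le (m : ℕ) : |coeff m cscSeries| ≤ 102 := by
  have h := abs_coeff_cscSeries_sub_two_le m
  have h10 : (1 / 4 : ℝ) ^ m ≤ 1 := pow_le_one₀ (by norm_num) (by norm_num)
  rw [abs_le] at h ⊢
  constructor <;> linarith

/-- The power series with coefficients `c_m - 2`, with `c_m` the coefficients of `cscSeries`. -/
def cscRemainder : ℝ⟦X⟧ := mk fun m => coeff m cscSeries - 2

lemma geometricDecay_cscRemainder : GeometricDecay cscRemainder :=
  ⟨100, fun m => by simpa [cscRemainder] using abs_coeff_cscSeries_sub_two_le m⟩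

lemma geometricDecay_sincHalfSeries : GeometricDecay sincHalfSeries := by
  obtain ⟨K, hK⟩ := geometricDecay_sincSeries
  refine ⟨K, fun m => ?_⟩
  rw [sincHalfSeries, PowerSeries.coeff_rescale, abs_mul, abs_of_pos (by positivity)]
  refine le_trans (mul_le_of_le_one_left (abs_nonneg _) ?_) (hK m)
  exact pow_le_one₀ (by norm_num) (by norm_num)

lemma geometricDecay_cscHalfSeries : GeometricDecay cscHalfSeries := by
  refine ⟨102, fun m => ?_⟩
  rw [cscHalfSeries, PowerSeries.coeff_rescale, abs_mul, abs_of_pos (by positivity), mul_comm]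
  exact mul_le_mul_of_nonneg_right (abs_coeff_cscSeries_le m) (by positivity)

/-- Multiplication by the principal part `2/(1 - v)` of the cosecant sums coefficients. -/
lemma coeff_cscSeries_mul (q : ℝ⟦X⟧) (n : ℕ) :
    coeff n (cscSeries * q) = 2 * ∑ j ∈ Finset.range (n + 1), coeff j q +
      coeff n (cscRemainder * q) := by
  have h : cscSeries = PowerSeries.C 2 * mk (fun _ => 1) + cscRemainder := by
    ext m
    rw [map_add, PowerSeries.coeff_C_mul, cscRemainder, PowerSeries.coeff_mk, PowerSeries.coeff_mk]
    ring
  rw [h, add_mul, map_add, mul_assoc, PowerSeries.coeff_C_mul, mul_comm (PowerSeries.mk _) q,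
    PowerSeries.coeff_mul, Finset.Nat.sum_antidiagonal_eq_sum_range_succ_mk]
  simp

/-- The tail telescopes through `1/(j+1)² ≤ 1/j - 1/(j+1)`. -/
lemma abs_sum_sub_tsum_le {f : ℕ → ℝ} (hf : Summable f) {B : ℝ}
    (hB : ∀ j, |f j| * ((j : ℝ) + 1) ^ 2 ≤ B) (n : ℕ) :
    |∑ j ∈ Finset.range (n + 1), f j - ∑' j, f j| ≤ B / ((n : ℝ) + 1) := by
  have hB0 : 0 ≤ B := (by positivity : (0 : ℝ) ≤ |f 0| * (((0 : ℕ) : ℝ) + 1) ^ 2).trans (hB 0)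
  have h1 : ∀ k : ℕ, |∑ j ∈ Finset.range (n + 1), f j - ∑ j ∈ Finset.range (n + k + 1), f j| ≤
      B / ((n : ℝ) + 1) - B / (((n + k : ℕ) : ℝ) + 1) := by
    intro k
    induction k with
    | zero => simp
    | succ k ih =>
      rw [← add_assoc n k 1, Finset.sum_range_succ f (n + k + 1), ← sub_sub]
      refine (abs_sub _ _).trans ?_
      have h2 : |f (n + k + 1)| ≤
          B / (((n + k : ℕ) : ℝ) + 1) - B / (((n + k + 1 : ℕ) : ℝ) + 1) := by
        have h3 := hB (n + k + 1)
        set x : ℝ := ((n + k : ℕ) : ℝ)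
        have hx : 0 ≤ x := Nat.cast_nonneg _
        rw [Nat.cast_succ] at h3 ⊢
        change |f (n + k + 1)| * (x + 1 + 1) ^ 2 ≤ B at h3
        change |f (n + k + 1)| ≤ B / (x + 1) - B / (x + 1 + 1)
        rw [← le_div_iff₀ (by positivity)] at h3
        refine h3.trans ?_
        rw [div_sub_div _ _ (by positivity) (by positivity), div_le_div_iff₀ (by positivity)
          (by positivity)]
        nlinarith [mul_nonneg hB0 hx, mul_nonneg hB0 (mul_nonneg hx hx)]
      linarith
  have h4 : Tendsto (fun k : ℕ => |∑ j ∈ Finset.range (n + 1), f j -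
      ∑ j ∈ Finset.range (n + k + 1), f j|) atTop
      (𝓝 |∑ j ∈ Finset.range (n + 1), f j - ∑' j, f j|) := by
    have h5 := hf.hasSum.tendsto_sum_nat.comp (tendsto_add_atTop_nat (n + 1))
    refine (tendsto_const_nhds.sub (h5.congr fun k => ?_)).abs
    simp only [Function.comp_apply]
    rw [show k + (n + 1) = n + k + 1 by ring]
  refine le_of_tendsto' h4 fun k => (h1 k).trans ?_
  have : 0 ≤ B / (((n + k : ℕ) : ℝ) + 1) := by positivity
  linarith

section

/-! ### The coefficients of the solution of the Legendre equation -/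

/-- The flux `S ϑ W` of a power series `W`, with `ϑ = v d/dv` and `S` the cardinal sine. -/
def flux (W : ℝ⟦X⟧) : ℝ⟦X⟧ := sincSeries * (PowerSeries.X * PowerSeries.derivative ℝ W)

/-- The Legendre equation `ϑ (S ϑ W) = (π ^ 2 / 16) v S W`. -/
def IsLegendreSolution (W : ℝ⟦X⟧) : Prop :=
  PowerSeries.X * PowerSeries.derivative ℝ (flux W) =
    PowerSeries.C (Real.pi ^ 2 / 16) * (PowerSeries.X * (sincSeries * W))

variable {W : ℝ⟦X⟧}

lemma coeff_zero_flux : coeff 0 (flux W) = 0 := by simp [flux]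

lemma cscSeries_mul_flux :
    cscSeries * flux W = PowerSeries.X * PowerSeries.derivative ℝ W := by
  rw [flux, ← mul_assoc, mul_comm cscSeries, sincSeries_mul_cscSeries, one_mul]

lemma coeff_cscSeries_mul_flux (n : ℕ) : (n : ℝ) * coeff n W = coeff n (cscSeries * flux W) := by
  rw [cscSeries_mul_flux, coeff_X_mul_derivative]

namespace IsLegendreSolution

lemma coeff_flux_succ (h : IsLegendreSolution W) (n : ℕ) :
    coeff (n + 1) (flux W) * ((n : ℝ) + 1) = Real.pi ^ 2 / 16 * coeff n (sincSeries * W) := by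
  have h1 := congrArg (coeff (n + 1)) h
  rw [coeff_X_mul_derivative, PowerSeries.coeff_C_mul, PowerSeries.coeff_succ_X_mul] at h1
  rw [← h1]
  push_cast
  ring

lemma pi_sq_div_le : Real.pi ^ 2 / 16 ≤ 1 := by nlinarith [Real.pi_lt_d2, Real.pi_pos]

lemma abs_coeff_flux_succ_le (h : IsLegendreSolution W) (n : ℕ) :
    |coeff (n + 1) (flux W)| * ((n : ℝ) + 1) ≤ |coeff n (sincSeries * W)| := by
  have h1 := congrArg abs (h.coeff_flux_succ n)
  rw [abs_mul, abs_mul, abs_of_pos (by positivity : (0 : ℝ) < (n : ℝ) + 1),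
    abs_of_pos (by positivity : (0 : ℝ) < Real.pi ^ 2 / 16)] at h1
  rw [h1]
  exact mul_le_of_le_one_left (abs_nonneg _) pi_sq_div_le

lemma abs_coeff_mul_le (n : ℕ) :
    (n : ℝ) * |coeff n W| ≤ 102 * ∑ j ∈ Finset.range n, |coeff (j + 1) (flux W)| := by
  have h1 := congrArg abs (coeff_cscSeries_mul_flux (W := W) n)
  rw [abs_mul, abs_of_nonneg n.cast_nonneg] at h1
  rw [h1, mul_comm cscSeries, PowerSeries.coeff_mul,
    Finset.Nat.sum_antidiagonal_eq_sum_range_succ_mk, Finset.sum_range_succ', Finset.mul_sum]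
  simp only [coeff_zero_flux, zero_mul, add_zero]
  refine (Finset.abs_sum_le_sum_abs _ _).trans (Finset.sum_le_sum fun j _ => ?_)
  rw [abs_mul, mul_comm]
  exact mul_le_mul_of_nonneg_right (abs_coeff_cscSeries_le _) (abs_nonneg _)

lemma one_add_log_le_sqrt {n : ℕ} (hn : 1 ≤ n) : 1 + Real.log n ≤ 2 * √(n : ℝ) := by
  have hn' : (0 : ℝ) < n := by exact_mod_cast hn
  have h1 := Real.log_le_sub_one_of_pos (Real.sqrt_pos.2 hn')
  rw [Real.log_sqrt hn'.le] at h1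
  linarith

/-- First step of the bootstrap. If the earlier coefficients are at most `M`, the flux has
coefficients `O(M/j)`; summing them costs a logarithm, absorbed by `√n`, and dividing by the `n` of
`ϑ` gains a factor `√n`. -/
lemma exists_sqrt_mul_abs_coeff_le (h : IsLegendreSolution W) :
    ∃ D : ℝ, 0 ≤ D ∧ ∀ (n : ℕ) (M : ℝ), 0 ≤ M → 1 ≤ n → (∀ j < n, |coeff j W| ≤ M) →
      √(n : ℝ) * |coeff n W| ≤ D * M := by
  have hS := geometricDecay_sincSeries.summable 0
  set A := ∑' i : ℕ, |coeff i sincSeries| * ((i : ℝ) + 1) ^ 0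
  have hA : 0 ≤ A := tsum_nonneg fun i => by positivity
  refine ⟨204 * A, by positivity, fun n M hM hn hW => ?_⟩
  have h1 : ∀ j ∈ Finset.range n, |coeff (j + 1) (flux W)| ≤ A * M * ((j : ℝ) + 1)⁻¹ := by
    intro j hj
    have hj' := Finset.mem_range.1 hj
    rw [← div_eq_mul_inv, le_div_iff₀ (by positivity)]
    refine (h.abs_coeff_flux_succ_le j).trans ?_
    have h2 := abs_coeff_mul_le_of_weight (w := fun n => ((n : ℝ) + 1) ^ 0) (fun n => by positivity)
      (succ_pow_submultiplicative 0) hS (B := M) (n := j) (q := W)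
      (fun i hi => by simpa using hW i (by omega))
    simpa [A] using h2
  have h3 : ∑ j ∈ Finset.range n, ((j : ℝ) + 1)⁻¹ ≤ 1 + Real.log n := by
    have := harmonic_le_one_add_log n
    rw [harmonic] at this
    push_cast at this
    exact this
  have hn0 : (0 : ℝ) < n := by exact_mod_cast hn
  have hs0 := Real.sqrt_pos.2 hn0
  have h4 : (n : ℝ) * |coeff n W| ≤ 102 * (A * M * (2 * √(n : ℝ))) := by
    refine (abs_coeff_mul_le n).trans (mul_le_mul_of_nonneg_left ?_ (by norm_num))
    refine (Finset.sum_le_sum h1).trans ?_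
    rw [← Finset.mul_sum]
    exact mul_le_mul_of_nonneg_left (h3.trans (one_add_log_le_sqrt hn)) (by positivity)
  have h5 : (n : ℝ) = √(n : ℝ) * √(n : ℝ) := (Real.mul_self_sqrt hn0.le).symm
  refine le_of_mul_le_mul_left ?_ hs0
  rw [← mul_assoc, ← h5]
  linarith

/-- As soon as `√n ≥ D` the previous estimate reproduces the bound `M`, so a bound on the finitely
many initial coefficients propagates. -/
lemma exists_abs_coeff_le (h : IsLegendreSolution W) :
    ∃ M : ℝ, 0 ≤ M ∧ ∀ n, |coeff n W| ≤ M := by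
  obtain ⟨D, hD, hstep⟩ := h.exists_sqrt_mul_abs_coeff_le
  obtain ⟨N, hN⟩ := exists_nat_gt (D ^ 2)
  set M := ∑ j ∈ Finset.range (N + 1), |coeff j W|
  have hM : 0 ≤ M := Finset.sum_nonneg fun j _ => abs_nonneg _
  refine ⟨M, hM, fun n => ?_⟩
  induction n using Nat.strong_induction_on with
  | _ n ih =>
    rcases lt_or_ge n (N + 1) with hn | hn
    · exact Finset.single_le_sum (f := fun j => |coeff j W|) (fun j _ => abs_nonneg _)
        (Finset.mem_range.2 hn)
    · have h1 := hstep n M hM (by omega) ih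
      have h2 : D ≤ √(n : ℝ) := by
        refine Real.le_sqrt_of_sq_le (hN.le.trans ?_)
        exact_mod_cast (by omega : N ≤ n)
      have hs0 : 0 < √(n : ℝ) := Real.sqrt_pos.2 (by exact_mod_cast (by omega : 0 < n))
      exact le_of_mul_le_mul_left (h1.trans (mul_le_mul_of_nonneg_right h2 hM)) hs0

lemma exists_abs_coeff_mul_sqrt_le (h : IsLegendreSolution W) :
    ∃ B : ℝ, ∀ n : ℕ, |coeff n W| * √((n : ℝ) + 1) ≤ B := by
  obtain ⟨D, hD, hstep⟩ := h.exists_sqrt_mul_abs_coeff_le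
  obtain ⟨M, hM, hW⟩ := h.exists_abs_coeff_le
  refine ⟨2 * (D * M) + M, fun n => ?_⟩
  rcases Nat.eq_zero_or_pos n with rfl | hn
  · have := hW 0
    have h0 : 0 ≤ D * M := by positivity
    simp only [Nat.cast_zero, zero_add, Real.sqrt_one, mul_one]
    linarith
  · have h1 := hstep n M hM hn fun j _ => hW j
    have hn' : (1 : ℝ) ≤ n := by exact_mod_cast hn
    have h2 : √((n : ℝ) + 1) ≤ 2 * √(n : ℝ) := by
      rw [Real.sqrt_le_left (by positivity), mul_pow, Real.sq_sqrt (by positivity)]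
      linarith
    calc |coeff n W| * √((n : ℝ) + 1) ≤ |coeff n W| * (2 * √(n : ℝ)) :=
          mul_le_mul_of_nonneg_left h2 (abs_nonneg _)
      _ = 2 * (√(n : ℝ) * |coeff n W|) := by ring
      _ ≤ 2 * (D * M) + M := by linarith

/-- With `W_n = O(n^{-1/2})`, the equation gains a factor `1/n` and the flux coefficients are
`O(n^{-3/2})`. Summability removes the logarithm, so that next `W_n = O(1/n)` and the flux
coefficients are `O(1/n²)`. -/
lemma summable_abs_coeff_flux (h : IsLegendreSolution W) :
    Summable fun n => |coeff n (flux W)| := by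
  obtain ⟨B, hB⟩ := h.exists_abs_coeff_mul_sqrt_le
  set K := (∑' i : ℕ, |coeff i sincSeries| * √((i : ℝ) + 1)) * B
  have h1 : ∀ n : ℕ, |coeff n (sincSeries * W)| * √((n : ℝ) + 1) ≤ K := fun n =>
    abs_coeff_mul_le_of_weight (w := fun n => √((n : ℝ) + 1)) (fun n => by positivity)
      sqrt_succ_submultiplicative geometricDecay_sincSeries.summable_sqrt fun j _ => hB j
  have h2 : Summable fun n : ℕ => K * (1 / (n : ℝ) ^ (3 / 2 : ℝ)) :=
    (Real.summable_one_div_nat_rpow.2 (by norm_num)).mul_left K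
  refine (summable_nat_add_iff 1).1 (Summable.of_nonneg_of_le (fun n => abs_nonneg _) (fun n => ?_)
    ((summable_nat_add_iff 1).2 h2))
  have hn : (0 : ℝ) < (n : ℝ) + 1 := by positivity
  have h3 : (((n + 1 : ℕ) : ℝ)) ^ (3 / 2 : ℝ) = ((n : ℝ) + 1) * √((n : ℝ) + 1) := by
    rw [Nat.cast_succ, Real.sqrt_eq_rpow, show (3 / 2 : ℝ) = 1 + 1 / 2 by norm_num,
      Real.rpow_add hn, Real.rpow_one]
  rw [h3, mul_one_div, le_div_iff₀ (by positivity), ← mul_assoc]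
  exact (mul_le_mul_of_nonneg_right (h.abs_coeff_flux_succ_le n) (Real.sqrt_nonneg _)).trans (h1 n)

lemma exists_abs_coeff_mul_succ_le (h : IsLegendreSolution W) :
    ∃ B : ℝ, ∀ n : ℕ, |coeff n W| * ((n : ℝ) + 1) ^ 1 ≤ B := by
  obtain ⟨M, hM, hW⟩ := h.exists_abs_coeff_le
  have hs := (summable_nat_add_iff 1).2 h.summable_abs_coeff_flux
  refine ⟨102 * (∑' n, |coeff (n + 1) (flux W)|) + M, fun n => ?_⟩
  have h1 := abs_coeff_mul_le (W := W) n
  have h2 := hs.sum_le_tsum (Finset.range n) fun i _ => abs_nonneg _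
  have h3 := hW n
  rw [pow_one, mul_add, mul_one]
  linarith

lemma exists_abs_coeff_flux_mul_sq_le (h : IsLegendreSolution W) :
    ∃ B : ℝ, ∀ n : ℕ, |coeff n (flux W)| * ((n : ℝ) + 1) ^ 2 ≤ B := by
  obtain ⟨B, hB⟩ := h.exists_abs_coeff_mul_succ_le
  obtain ⟨K, hK⟩ := geometricDecay_sincSeries.abs_coeff_mul_le 1 hB
  refine ⟨4 * K, fun n => ?_⟩
  have hK0 : 0 ≤ K := le_trans (by positivity) (hK 0)
  rcases n with _ | n
  · rw [coeff_zero_flux]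
    simpa using hK0
  · have h1 := h.abs_coeff_flux_succ_le n
    have h2 := hK n
    have hn : (0 : ℝ) ≤ n := n.cast_nonneg
    have h3 := mul_le_mul_of_nonneg_right h1 (by positivity : 0 ≤ (n : ℝ) + 1)
    rw [pow_one] at h2
    have h4 : (((n + 1 : ℕ) : ℝ) + 1) ^ 2 ≤ 4 * (((n : ℝ) + 1) * ((n : ℝ) + 1)) := by
      push_cast
      nlinarith
    have h5 := mul_le_mul_of_nonneg_left h4 (abs_nonneg (coeff (n + 1) (flux W)))
    linarith

/-- `n W_n` converges to twice the sum of the coefficients of the flux, with error `O(1 / n)`. -/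
lemma exists_abs_coeff_sub_le (h : IsLegendreSolution W) :
    ∃ K : ℝ, ∀ n : ℕ, |coeff n W - 2 * (∑' j, coeff j (flux W)) / ((n : ℝ) + 1)| *
      ((n : ℝ) + 1) ^ 2 ≤ K := by
  obtain ⟨B, hB⟩ := h.exists_abs_coeff_flux_mul_sq_le
  obtain ⟨R, hR⟩ := geometricDecay_cscRemainder.abs_coeff_mul_le 2 hB
  obtain ⟨M, hM⟩ := h.exists_abs_coeff_mul_succ_le
  set τ := ∑' j, coeff j (flux W)
  refine ⟨2 * B + R + M, fun n => ?_⟩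
  have h1 := coeff_cscSeries_mul_flux (W := W) n
  rw [coeff_cscSeries_mul] at h1
  have h2 := abs_sum_sub_tsum_le h.summable_abs_coeff_flux.of_abs hB n
  have hx : (1 : ℝ) ≤ (n : ℝ) + 1 := by linarith [n.cast_nonneg (α := ℝ)]
  have hR' := hR n
  have hM' := hM n
  rw [pow_one] at hM'
  set s := ∑ j ∈ Finset.range (n + 1), coeff j (flux W)
  set r := coeff n (cscRemainder * flux W)
  set w := coeff n W
  set x : ℝ := (n : ℝ) + 1 with hxdef
  have hx0 : 0 < x := by linarith
  -- The recursion reads `n w = 2 s + r`; the extra `w x` appears because the error is measured in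
  -- `x = n + 1`.
  have h3 : (w - 2 * τ / x) * x ^ 2 = 2 * ((s - τ) * x) + r * x + w * x := by
    have h4 : (n : ℝ) = x - 1 := by rw [hxdef]; ring
    rw [h4] at h1
    have h9 : (w - 2 * τ / x) * x ^ 2 = w * x ^ 2 - 2 * τ * x := by
      field_simp
    linear_combination h9 + x * h1
  have h5 : |(s - τ) * x| ≤ B := by
    rw [abs_mul, abs_of_pos hx0]
    exact (le_div_iff₀ hx0).1 h2
  have h6 : |r * x| ≤ R := by
    rw [abs_mul, abs_of_pos hx0]
    refine le_trans (mul_le_mul_of_nonneg_left ?_ (abs_nonneg _)) hR'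
    nlinarith
  have h7 : |w * x| ≤ M := by
    rw [abs_mul, abs_of_pos hx0]
    exact hM'
  have h8 : |w - 2 * τ / x| * x ^ 2 = |(w - 2 * τ / x) * x ^ 2| := by
    rw [abs_mul, abs_of_pos (by positivity : 0 < x ^ 2)]
  rw [h8, h3]
  rw [abs_le] at h5 h6 h7 ⊢
  constructor <;> linarith [h5.1, h5.2, h6.1, h6.2, h7.1, h7.2]

end IsLegendreSolution

end

/-! ### Evaluation of real power series on the unit interval -/

/-- The coefficients have at most polynomial growth. -/
def PolynomialGrowth (p : ℝ⟦X⟧) : Prop :=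
  ∃ (M : ℝ) (r : ℕ), ∀ n, |coeff n p| ≤ M * ((n : ℝ) + 1) ^ r

/-- The sum of a real power series. -/
def evalSeries (p : ℝ⟦X⟧) (x : ℝ) : ℝ := ∑' n, coeff n p * x ^ n

lemma PolynomialGrowth.of_bounded {p : ℝ⟦X⟧} {M : ℝ} (h : ∀ n, |coeff n p| ≤ M) :
    PolynomialGrowth p := ⟨M, 0, fun n => by simpa using h n⟩

lemma PolynomialGrowth.derivative {p : ℝ⟦X⟧} (h : PolynomialGrowth p) :
    PolynomialGrowth (PowerSeries.derivative ℝ p) := by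
  obtain ⟨M, r, hM⟩ := h
  have hM0 : 0 ≤ M := by
    have := (abs_nonneg _).trans (hM 0)
    simpa using this
  refine ⟨M * 2 ^ r, r + 1, fun n => ?_⟩
  rw [PowerSeries.coeff_derivative, abs_mul, abs_of_pos (by positivity : (0 : ℝ) < (n : ℝ) + 1),
    pow_succ, ← mul_assoc]
  refine mul_le_mul_of_nonneg_right ((hM (n + 1)).trans ?_) (by positivity)
  rw [mul_assoc, ← mul_pow]
  refine mul_le_mul_of_nonneg_left (pow_le_pow_left₀ (by positivity) ?_ r) hM0
  push_cast
  linarith [n.cast_nonneg (α := ℝ)]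

lemma summable_succ_pow_mul_geometric (r : ℕ) {x : ℝ} (hx0 : 0 < x) (hx : x < 1) :
    Summable fun n : ℕ => ((n : ℝ) + 1) ^ r * x ^ n := by
  have h1 : Summable fun n : ℕ => ((n : ℝ)) ^ r * x ^ n :=
    summable_pow_mul_geometric_of_norm_lt_one r (by rwa [Real.norm_of_nonneg hx0.le])
  have h2 := ((summable_nat_add_iff 1).2 h1).mul_left x⁻¹
  refine h2.congr fun n => ?_
  push_cast
  rw [pow_succ]
  field_simp

lemma PolynomialGrowth.summable_abs {p : ℝ⟦X⟧} (h : PolynomialGrowth p) {x : ℝ} (hx : |x| < 1) :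
    Summable fun n => ‖coeff n p * x ^ n‖ := by
  obtain ⟨M, r, hM⟩ := h
  obtain ⟨y, hxy, hy⟩ := exists_between hx
  have hy0 : 0 < y := (abs_nonneg x).trans_lt hxy
  have hM0 : 0 ≤ M := by
    have := (abs_nonneg _).trans (hM 0)
    simpa using this
  refine Summable.of_nonneg_of_le (fun n => norm_nonneg _) (fun n => ?_)
    ((summable_succ_pow_mul_geometric r hy0 hy).mul_left M)
  rw [norm_mul, norm_pow, Real.norm_eq_abs, Real.norm_eq_abs, ← mul_assoc]
  have := hM n
  gcongr

lemma PolynomialGrowth.hasDerivAt {p : ℝ⟦X⟧} (h : PolynomialGrowth p) {x : ℝ} (hx : |x| < 1) :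
    HasDerivAt (evalSeries p) (evalSeries (PowerSeries.derivative ℝ p) x) x := by
  obtain ⟨y, hxy, hy⟩ := exists_between hx
  have hy0 : 0 < y := (abs_nonneg x).trans_lt hxy
  have h1 := h.derivative.summable_abs (x := y) (by rwa [abs_of_pos hy0])
  have hu : Summable fun n : ℕ => |coeff n p| * (n * y ^ (n - 1)) := by
    refine (summable_nat_add_iff 1).1 (h1.congr fun n => ?_)
    rw [PowerSeries.coeff_derivative, norm_mul, norm_mul, norm_pow, Real.norm_of_nonneg hy0.le,
      Real.norm_eq_abs, Real.norm_of_nonneg (by positivity)]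
    push_cast
    ring
  have h2 := hasDerivAt_tsum_of_isPreconnected (u := fun n : ℕ => |coeff n p| * (n * y ^ (n - 1)))
    (g := fun n x => coeff n p * x ^ n) (g' := fun n x => coeff n p * (n * x ^ (n - 1)))
    (t := Metric.ball 0 y) (y₀ := 0) (y := x) hu Metric.isOpen_ball
    (convex_ball (0 : ℝ) y).isPreconnected
    (fun n z _ => (hasDerivAt_pow n z).const_mul _)
    (fun n z hz => by
      have hz' : |z| ≤ y := by
        have := Metric.mem_ball.1 hz
        rw [dist_zero_right, Real.norm_eq_abs] at this
        exact this.le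
      rw [norm_mul, norm_mul, norm_pow, Real.norm_eq_abs, Real.norm_eq_abs, Real.norm_eq_abs,
        Nat.abs_cast]
      gcongr)
    (by simpa using hy0) (h.summable_abs (x := 0) (by simp)).of_norm
    (by simpa [dist_zero_right] using hxy)
  refine h2.congr_deriv ?_
  have h3 : Summable fun n : ℕ => coeff n p * (n * x ^ (n - 1)) := by
    refine Summable.of_norm_bounded hu fun n => ?_
    rw [norm_mul, norm_mul, norm_pow, Real.norm_eq_abs, Real.norm_eq_abs, Real.norm_eq_abs,
      Nat.abs_cast]
    gcongr
  rw [h3.tsum_eq_zero_add, evalSeries]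
  simp only [Nat.cast_zero, zero_mul, mul_zero, zero_add]
  refine tsum_congr fun n => ?_
  rw [PowerSeries.coeff_derivative]
  push_cast
  ring

lemma evalSeries_mul {p q : ℝ⟦X⟧} (hp : PolynomialGrowth p) (hq : PolynomialGrowth q) {x : ℝ}
    (hx : |x| < 1) : evalSeries (p * q) x = evalSeries p x * evalSeries q x := by
  rw [evalSeries, evalSeries, evalSeries,
    tsum_mul_tsum_eq_tsum_sum_antidiagonal_of_summable_norm (hp.summable_abs hx)
      (hq.summable_abs hx)]
  refine tsum_congr fun n => ?_
  rw [PowerSeries.coeff_mul, Finset.sum_mul]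
  refine Finset.sum_congr rfl fun ij hij => ?_
  rw [← Finset.HasAntidiagonal.mem_antidiagonal.1 hij, pow_add]
  ring

lemma evalSeries_C_mul (c : ℝ) (p : ℝ⟦X⟧) (x : ℝ) :
    evalSeries (PowerSeries.C c * p) x = c * evalSeries p x := by
  rw [evalSeries, evalSeries, ← tsum_mul_left]
  refine tsum_congr fun n => ?_
  rw [PowerSeries.coeff_C_mul, mul_assoc]

lemma evalSeries_zero (p : ℝ⟦X⟧) : evalSeries p 0 = coeff 0 p := by
  rw [evalSeries, tsum_eq_single 0 fun n hn => by simp [hn]]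
  simp

lemma PolynomialGrowth.X : PolynomialGrowth PowerSeries.X :=
  .of_bounded (M := 1) fun n => by rw [PowerSeries.coeff_X]; split_ifs <;> simp

lemma PolynomialGrowth.one_sub_X : PolynomialGrowth (1 - PowerSeries.X) :=
  .of_bounded (M := 2) fun n => by
    rw [map_sub, PowerSeries.coeff_X, PowerSeries.coeff_one]
    split_ifs <;> norm_num

lemma evalSeries_X (x : ℝ) : evalSeries PowerSeries.X x = x := by
  rw [evalSeries, tsum_eq_single 1 fun n hn => by simp [PowerSeries.coeff_X, hn]]
  simp

lemma evalSeries_one_sub_X (x : ℝ) : evalSeries (1 - PowerSeries.X) x = 1 - x := by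
  rw [evalSeries, tsum_eq_sum (s := Finset.range 2)]
  · simp [Finset.sum_range_succ, PowerSeries.coeff_X, PowerSeries.coeff_one]
    ring
  · intro n hn
    have hn' : 1 < n := by simpa using hn
    rw [map_sub, PowerSeries.coeff_X, PowerSeries.coeff_one, if_neg (by omega), if_neg (by omega)]
    simp

lemma GeometricDecay.polynomialGrowth {p : ℝ⟦X⟧} (h : GeometricDecay p) : PolynomialGrowth p := by
  obtain ⟨K, hK⟩ := h
  have hK0 : 0 ≤ K := by simpa using (abs_nonneg _).trans (hK 0)
  exact .of_bounded fun n => (hK n).trans (mul_le_of_le_one_right hK0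
    (pow_le_one₀ (by norm_num) (by norm_num)))

lemma evalSeries_sincSeries {v : ℝ} (hv : 0 < v) :
    evalSeries sincSeries v = Real.sin (Real.pi * √v) / (Real.pi * √v) := by
  have hs := Real.sqrt_pos.2 hv
  have hpi := Real.pi_pos
  have h := (Real.hasSum_sin (Real.pi * √v)).div_const (Real.pi * √v)
  rw [← h.tsum_eq, evalSeries]
  refine tsum_congr fun n => ?_
  rw [sincSeries, PowerSeries.coeff_mk, pow_succ (Real.pi * √v), pow_mul (Real.pi * √v),
    mul_pow Real.pi, Real.sq_sqrt hv.le, neg_pow, mul_pow]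
  field_simp

/-! ### The hypergeometric solution -/

/-- The generating function of the summands of the Landau constants. -/
def hypergeometricSeries : ℝ⟦X⟧ := mk landauTerm

/-- The flux `z (1 - z) F'` of the generating function. -/
def hypergeometricFlux : ℝ⟦X⟧ :=
  PowerSeries.X * ((1 - PowerSeries.X) * PowerSeries.derivative ℝ hypergeometricSeries)

lemma landauTerm_le_one (m : ℕ) : landauTerm m ≤ 1 := by
  induction m with
  | zero => rw [landauTerm_zero]
  | succ m ih =>
    rw [landauTerm_succ]
    refine mul_le_one₀ ih (by positivity) (pow_le_one₀ (by positivity) ?_)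
    rw [div_le_one (by positivity)]
    linarith

lemma polynomialGrowth_hypergeometricSeries : PolynomialGrowth hypergeometricSeries :=
  .of_bounded (M := 1) fun n => by
    rw [hypergeometricSeries, PowerSeries.coeff_mk, abs_of_pos (landauTerm_pos n)]
    exact landauTerm_le_one n

lemma coeff_zero_hypergeometricFlux : coeff 0 hypergeometricFlux = 0 := by
  simp [hypergeometricFlux]

lemma coeff_succ_hypergeometricFlux (n : ℕ) :
    coeff (n + 1) hypergeometricFlux = (n + 1) * landauTerm (n + 1) - n * landauTerm n := by
  rw [hypergeometricFlux, PowerSeries.coeff_succ_X_mul, sub_mul, one_mul, map_sub,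
    coeff_X_mul_derivative, PowerSeries.coeff_derivative]
  simp only [hypergeometricSeries, PowerSeries.coeff_mk]
  ring

/-- The hypergeometric equation `(z(1-z)F')' = F/4`, a restatement of `4(n+1)² a_{n+1} = (2n+1)²
a_n`. -/
lemma derivative_hypergeometricFlux :
    PowerSeries.derivative ℝ hypergeometricFlux = PowerSeries.C (1 / 4) * hypergeometricSeries := by
  ext n
  rw [PowerSeries.coeff_derivative, coeff_succ_hypergeometricFlux, PowerSeries.coeff_C_mul,
    landauTerm_succ, hypergeometricSeries, PowerSeries.coeff_mk]
  field_simp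
  ring

lemma polynomialGrowth_hypergeometricFlux : PolynomialGrowth hypergeometricFlux := by
  refine ⟨1, 1, fun n => ?_⟩
  rcases n with _ | n
  · rw [coeff_zero_hypergeometricFlux]
    simp
  · rw [coeff_succ_hypergeometricFlux, abs_le]
    have h1 := landauTerm_pos n
    have h2 := landauTerm_le_one n
    have h3 := landauTerm_pos (n + 1)
    have h4 := landauTerm_le_one (n + 1)
    have hn : (0 : ℝ) ≤ n := n.cast_nonneg
    push_cast
    constructor <;> nlinarith [mul_nonneg hn h1.le, mul_nonneg hn h3.le]

lemma sum_hypergeometricFlux (n : ℕ) :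
    ∑ j ∈ Finset.range (n + 1), coeff j hypergeometricFlux = n * landauTerm n := by
  induction n with
  | zero => simp [hypergeometricFlux]
  | succ n ih =>
    rw [Finset.sum_range_succ, ih, coeff_succ_hypergeometricFlux]
    push_cast
    ring

lemma landauTerm_mul_wallis (n : ℕ) :
    landauTerm n * (2 * n + 1) * Real.Wallis.W n = 1 := by
  induction n with
  | zero => simp [landauTerm_zero, Real.Wallis.W]
  | succ n ih =>
    rw [landauTerm_succ, Real.Wallis.W, Finset.prod_range_succ, ← Real.Wallis.W]
    have h1 : (0 : ℝ) < 2 * (n : ℝ) + 1 := by positivity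
    have h2 : (0 : ℝ) < 2 * (n : ℝ) + 3 := by positivity
    push_cast
    refine Eq.trans ?_ ih
    field_simp
    ring

lemma tendsto_mul_landauTerm :
    Tendsto (fun n : ℕ => (n : ℝ) * landauTerm n) atTop (𝓝 (1 / Real.pi)) := by
  have hpi := Real.pi_pos
  have h1 : Tendsto (fun n : ℕ => (n : ℝ) / (2 * n + 1)) atTop (𝓝 (1 / 2)) := by
    have h2 := (tendsto_natCast_div_add_atTop (1 / 2 : ℝ)).mul_const (1 / 2 : ℝ)
    rw [one_mul] at h2
    refine h2.congr fun n => ?_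
    field_simp
  have h3 := h1.div Real.Wallis.tendsto_W_nhds_pi_div_two (by positivity)
  have h4 : (1 / 2 : ℝ) / (Real.pi / 2) = 1 / Real.pi := by field_simp
  rw [h4] at h3
  refine h3.congr fun n => ?_
  have h5 := landauTerm_mul_wallis n
  have h6 : Real.Wallis.W n ≠ 0 := (Real.Wallis.W_pos n).ne'
  simp only [Pi.div_apply]
  field_simp
  linear_combination -(n : ℝ) * h5

/-- Abel's limit theorem: the coefficients telescope to the partial sums `n a_n`, whose limit is
given by Wallis' product. -/
lemma tendsto_evalSeries_hypergeometricFlux :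
    Tendsto (evalSeries hypergeometricFlux) (𝓝[<] 1) (𝓝 (1 / Real.pi)) := by
  refine Real.tendsto_tsum_powerSeries_nhdsWithin_lt ?_
  refine (tendsto_add_atTop_iff_nat 1).1 (tendsto_mul_landauTerm.congr fun n => ?_)
  exact (sum_hypergeometricFlux n).symm

section

/-! ### Identification of the Legendre solution with the hypergeometric one -/

lemma eq_of_hasDerivAt_zero_of_tendsto {f : ℝ → ℝ} {c : ℝ}
    (hf : ∀ v ∈ Set.Ioo (0 : ℝ) 1, HasDerivAt f 0 v) (hc : Tendsto f (𝓝[>] 0) (𝓝 c)) {v : ℝ}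
    (hv : v ∈ Set.Ioo (0 : ℝ) 1) : f v = c := by
  have h1 : ∀ u ∈ Set.Ioo (0 : ℝ) 1, f u = f v := fun u hu =>
    isOpen_Ioo.is_const_of_deriv_eq_zero isPreconnected_Ioo
      (fun x hx => (hf x hx).differentiableAt.differentiableWithinAt)
      (fun x hx => (hf x hx).deriv) hu hv
  have h2 : Tendsto f (𝓝[>] 0) (𝓝 (f v)) := by
    refine tendsto_const_nhds.congr' ?_
    filter_upwards [Ioo_mem_nhdsGT (zero_lt_one' ℝ)] with u hu
    exact (h1 u hu).symm
  exact tendsto_nhds_unique h2 hc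

/-- The change of variables `z = sin ^ 2 (π √v / 2)`. -/
def halfVersine (v : ℝ) : ℝ := (1 - Real.cos (Real.pi * √v)) / 2

variable {v : ℝ}

lemma pi_mul_sqrt_mem (hv : v ∈ Set.Ioo (0 : ℝ) 1) :
    Real.pi * √v ∈ Set.Ioo 0 Real.pi := by
  have hs : √v < 1 := by
    rw [Real.sqrt_lt' one_pos]
    simpa using hv.2
  exact ⟨mul_pos Real.pi_pos (Real.sqrt_pos.2 hv.1), mul_lt_of_lt_one_right Real.pi_pos hs⟩

lemma sin_pi_mul_sqrt_pos (hv : v ∈ Set.Ioo (0 : ℝ) 1) : 0 < Real.sin (Real.pi * √v) :=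
  Real.sin_pos_of_pos_of_lt_pi (pi_mul_sqrt_mem hv).1 (pi_mul_sqrt_mem hv).2

lemma evalSeries_sincSeries_pos (hv : v ∈ Set.Ioo (0 : ℝ) 1) : 0 < evalSeries sincSeries v := by
  rw [evalSeries_sincSeries hv.1]
  exact div_pos (sin_pi_mul_sqrt_pos hv) (pi_mul_sqrt_mem hv).1

lemma halfVersine_mem (hv : v ∈ Set.Ioo (0 : ℝ) 1) : halfVersine v ∈ Set.Ioo (0 : ℝ) 1 := by
  have h1 := sin_pi_mul_sqrt_pos hv
  have h2 := Real.sin_sq_add_cos_sq (Real.pi * √v)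
  unfold halfVersine
  constructor <;> nlinarith

lemma hasDerivAt_halfVersine (hv : v ∈ Set.Ioo (0 : ℝ) 1) :
    HasDerivAt halfVersine (Real.pi ^ 2 / 4 * evalSeries sincSeries v) v := by
  have hs := Real.sqrt_pos.2 hv.1
  have hpi := Real.pi_pos
  have h := ((((Real.hasDerivAt_sqrt hv.1.ne').const_mul Real.pi).cos.const_sub 1).div_const 2)
  refine h.congr_deriv ?_
  rw [evalSeries_sincSeries hv.1]
  field_simp
  norm_num

lemma continuous_halfVersine : Continuous halfVersine := by
  unfold halfVersine
  fun_prop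

lemma halfVersine_mul_one_sub (hv : v ∈ Set.Ioo (0 : ℝ) 1) :
    halfVersine v * (1 - halfVersine v) = Real.pi ^ 2 / 4 * v * evalSeries sincSeries v ^ 2 := by
  have hs := Real.sqrt_pos.2 hv.1
  have hpi := Real.pi_pos
  have h2 := Real.sin_sq_add_cos_sq (Real.pi * √v)
  have h3 : √v ^ 2 = v := Real.sq_sqrt hv.1.le
  rw [evalSeries_sincSeries hv.1, div_pow, mul_pow, h3, halfVersine]
  have := hv.1
  field_simp
  linear_combination -4 * h2

lemma abs_lt_one_of_mem (hv : v ∈ Set.Ioo (0 : ℝ) 1) : |v| < 1 := by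
  rw [abs_of_pos hv.1]
  exact hv.2

lemma evalSeries_hypergeometricSeries_pos (hv : v ∈ Set.Ioo (0 : ℝ) 1) :
    0 < evalSeries hypergeometricSeries v := by
  have h := (polynomialGrowth_hypergeometricSeries.summable_abs (abs_lt_one_of_mem hv)).of_norm
  refine lt_of_lt_of_le one_pos ?_
  have h2 := h.le_tsum 0 fun j _ => by
    rw [hypergeometricSeries, PowerSeries.coeff_mk]
    exact mul_nonneg (landauTerm_pos j).le (pow_nonneg hv.1.le j)
  simpa [evalSeries, hypergeometricSeries, landauTerm_zero] using h2

lemma hasDerivAt_hypergeometricSeries_comp (hv : v ∈ Set.Ioo (0 : ℝ) 1) :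
    HasDerivAt (fun v => evalSeries hypergeometricSeries (halfVersine v))
      (evalSeries (PowerSeries.derivative ℝ hypergeometricSeries) (halfVersine v) *
        (Real.pi ^ 2 / 4 * evalSeries sincSeries v)) v :=
  (polynomialGrowth_hypergeometricSeries.hasDerivAt
    (abs_lt_one_of_mem (halfVersine_mem hv))).comp v (hasDerivAt_halfVersine hv)

lemma hasDerivAt_hypergeometricFlux_comp (hv : v ∈ Set.Ioo (0 : ℝ) 1) :
    HasDerivAt (fun v => evalSeries hypergeometricFlux (halfVersine v))
      (Real.pi ^ 2 / 16 * evalSeries sincSeries v *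
        evalSeries hypergeometricSeries (halfVersine v)) v := by
  refine ((polynomialGrowth_hypergeometricFlux.hasDerivAt
    (abs_lt_one_of_mem (halfVersine_mem hv))).comp v (hasDerivAt_halfVersine hv)).congr_deriv ?_
  rw [derivative_hypergeometricFlux, evalSeries_C_mul]
  ring

/-- As `dz/dv = (π²/4) S` and `z(1-z) = (π²/4) v S²`, the substitution carries `z(1-z) d/dz` to `S v
d/dv`. Hence the hypergeometric flux is the Legendre flux of `F(z(v))`. -/
lemma evalSeries_hypergeometricFlux_comp (hv : v ∈ Set.Ioo (0 : ℝ) 1) :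
    evalSeries hypergeometricFlux (halfVersine v) = evalSeries sincSeries v * v *
      (evalSeries (PowerSeries.derivative ℝ hypergeometricSeries) (halfVersine v) *
        (Real.pi ^ 2 / 4 * evalSeries sincSeries v)) := by
  have hz := abs_lt_one_of_mem (halfVersine_mem hv)
  have hd := polynomialGrowth_hypergeometricSeries.derivative
  have h1 : hypergeometricFlux = (PowerSeries.X - PowerSeries.X ^ 2) *
      PowerSeries.derivative ℝ hypergeometricSeries := by
    rw [hypergeometricFlux]
    ring
  have h2 : PolynomialGrowth (PowerSeries.X - PowerSeries.X ^ 2) :=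
    .of_bounded (M := 2) fun n => by
      rw [map_sub, PowerSeries.coeff_X, PowerSeries.coeff_X_pow]
      split_ifs <;> norm_num
  have h3 : PowerSeries.X - PowerSeries.X ^ 2 = PowerSeries.X * (1 - PowerSeries.X : ℝ⟦X⟧) := by
    ring
  rw [h1, evalSeries_mul h2 hd hz, h3, evalSeries_mul .X .one_sub_X hz, evalSeries_X,
    evalSeries_one_sub_X, halfVersine_mul_one_sub hv]
  ring

namespace IsLegendreSolution

variable {W : ℝ⟦X⟧}

lemma polynomialGrowth (h : IsLegendreSolution W) : PolynomialGrowth W := by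
  obtain ⟨M, _, hM⟩ := h.exists_abs_coeff_le
  exact .of_bounded hM

lemma polynomialGrowth_flux (h : IsLegendreSolution W) : PolynomialGrowth (flux W) := by
  obtain ⟨B, hB⟩ := h.exists_abs_coeff_flux_mul_sq_le
  refine .of_bounded (M := B) fun n => le_trans ?_ (hB n)
  refine le_mul_of_one_le_right (abs_nonneg _) ?_
  exact one_le_pow₀ (by linarith [n.cast_nonneg (α := ℝ)])

lemma evalSeries_flux (h : IsLegendreSolution W) (hv : |v| < 1) :
    evalSeries (flux W) v = evalSeries sincSeries v * v *
      evalSeries (PowerSeries.derivative ℝ W) v := by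
  have hd := h.polynomialGrowth.derivative
  have hX : PolynomialGrowth (PowerSeries.X * PowerSeries.derivative ℝ W) := by
    obtain ⟨M, r, hM⟩ := hd
    have hM0 : 0 ≤ M := by simpa using (abs_nonneg _).trans (hM 0)
    refine ⟨M, r, fun n => ?_⟩
    rcases n with _ | n
    · simpa using hM0
    · rw [PowerSeries.coeff_succ_X_mul]
      refine (hM n).trans ?_
      push_cast
      gcongr
      linarith
  rw [flux, evalSeries_mul geometricDecay_sincSeries.polynomialGrowth hX hv,
    evalSeries_mul .X hd hv, evalSeries_X, mul_assoc]

lemma derivative_flux (h : IsLegendreSolution W) :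
    PowerSeries.derivative ℝ (flux W) = PowerSeries.C (Real.pi ^ 2 / 16) * (sincSeries * W) := by
  refine mul_left_cancel₀ (PowerSeries.X_ne_zero (R := ℝ)) ?_
  rw [show PowerSeries.X * PowerSeries.derivative ℝ (flux W) = _ from h]
  ring

lemma hasDerivAt_flux (h : IsLegendreSolution W) (hv : |v| < 1) :
    HasDerivAt (evalSeries (flux W))
      (Real.pi ^ 2 / 16 * evalSeries sincSeries v * evalSeries W v) v := by
  refine (h.polynomialGrowth_flux.hasDerivAt hv).congr_deriv ?_
  rw [h.derivative_flux, evalSeries_C_mul,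
    evalSeries_mul geometricDecay_sincSeries.polynomialGrowth h.polynomialGrowth hv, mul_assoc]

lemma tendsto_evalSeries_zero {p : ℝ⟦X⟧} (hp : PolynomialGrowth p) :
    Tendsto (evalSeries p) (𝓝[>] 0) (𝓝 (coeff 0 p)) := by
  have := (hp.hasDerivAt (x := 0) (by simp)).continuousAt.tendsto
  rw [evalSeries_zero] at this
  exact this.mono_left nhdsWithin_le_nhds

lemma tendsto_evalSeries_halfVersine_zero {p : ℝ⟦X⟧} (hp : PolynomialGrowth p) :
    Tendsto (fun v => evalSeries p (halfVersine v)) (𝓝[>] 0) (𝓝 (coeff 0 p)) := by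
  have h0 : halfVersine 0 = 0 := by simp [halfVersine]
  have h1 := (hp.hasDerivAt (x := 0) (by simp)).continuousAt.tendsto
  rw [evalSeries_zero] at h1
  have h2 := continuous_halfVersine.tendsto 0
  rw [h0] at h2
  exact (h1.comp h2).mono_left nhdsWithin_le_nhds

/-- `W` and `F(z(v))` solve the same self-adjoint equation, so `S v` times their Wronskian is
constant; it tends to 0 at the origin, where both fluxes vanish. -/
lemma wronskian_eq_zero (h : IsLegendreSolution W) (hv : v ∈ Set.Ioo (0 : ℝ) 1) :
    evalSeries (flux W) v * evalSeries hypergeometricSeries (halfVersine v) -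
      evalSeries W v * evalSeries hypergeometricFlux (halfVersine v) = 0 := by
  refine eq_of_hasDerivAt_zero_of_tendsto (f := fun v => evalSeries (flux W) v *
    evalSeries hypergeometricSeries (halfVersine v) -
      evalSeries W v * evalSeries hypergeometricFlux (halfVersine v)) (fun x hx => ?_) ?_ hv
  · have hx' := abs_lt_one_of_mem hx
    refine (((h.hasDerivAt_flux hx').mul (hasDerivAt_hypergeometricSeries_comp hx)).sub
      ((h.polynomialGrowth.hasDerivAt hx').mul
        (hasDerivAt_hypergeometricFlux_comp hx))).congr_deriv ?_
    rw [h.evalSeries_flux hx', evalSeries_hypergeometricFlux_comp hx]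
    ring
  · have h1 := ((tendsto_evalSeries_zero h.polynomialGrowth_flux).mul
      (tendsto_evalSeries_halfVersine_zero polynomialGrowth_hypergeometricSeries)).sub
      ((tendsto_evalSeries_zero h.polynomialGrowth).mul
        (tendsto_evalSeries_halfVersine_zero polynomialGrowth_hypergeometricFlux))
    rw [coeff_zero_flux, coeff_zero_hypergeometricFlux] at h1
    simpa using h1

/-- The quotient `W/F(z(v))` has zero derivative because the Wronskian vanishes, and it tends to 1
at the origin. Its denominator is positive since all `a_m` are. -/
lemma evalSeries_eq (h : IsLegendreSolution W) (h0 : coeff 0 W = 1) (hv : v ∈ Set.Ioo (0 : ℝ) 1) :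
    evalSeries W v = evalSeries hypergeometricSeries (halfVersine v) := by
  have hpos : ∀ x ∈ Set.Ioo (0 : ℝ) 1, 0 < evalSeries hypergeometricSeries (halfVersine x) :=
    fun x hx => evalSeries_hypergeometricSeries_pos (halfVersine_mem hx)
  have h1 : evalSeries W v / evalSeries hypergeometricSeries (halfVersine v) = 1 := by
    refine eq_of_hasDerivAt_zero_of_tendsto (f := fun v => evalSeries W v /
      evalSeries hypergeometricSeries (halfVersine v)) (fun x hx => ?_) ?_ hv
    · have hx' := abs_lt_one_of_mem hx
      refine ((h.polynomialGrowth.hasDerivAt hx').div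
        (hasDerivAt_hypergeometricSeries_comp hx) (hpos x hx).ne').congr_deriv ?_
      have h2 := h.wronskian_eq_zero hx
      rw [h.evalSeries_flux hx', evalSeries_hypergeometricFlux_comp hx] at h2
      have h3 : evalSeries sincSeries x * x ≠ 0 :=
        (mul_pos (evalSeries_sincSeries_pos hx) hx.1).ne'
      rw [div_eq_zero_iff]
      left
      refine (mul_eq_zero.1 (?_ : evalSeries sincSeries x * x * _ = 0)).resolve_left h3
      rw [← h2]
      ring
    · have h1 := (tendsto_evalSeries_zero h.polynomialGrowth).div
        (tendsto_evalSeries_halfVersine_zero polynomialGrowth_hypergeometricSeries)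
        (by simp [hypergeometricSeries, landauTerm_zero])
      have h2 : coeff 0 hypergeometricSeries = 1 := by
        rw [hypergeometricSeries, PowerSeries.coeff_mk, landauTerm_zero]
      rw [h0, h2, div_one] at h1
      exact h1
  exact (div_eq_one_iff_eq (hpos v hv).ne').1 h1

lemma evalSeries_flux_eq (h : IsLegendreSolution W) (h0 : coeff 0 W = 1)
    (hv : v ∈ Set.Ioo (0 : ℝ) 1) :
    evalSeries (flux W) v = evalSeries hypergeometricFlux (halfVersine v) := by
  have h1 := h.wronskian_eq_zero hv
  have hpos := evalSeries_hypergeometricSeries_pos (halfVersine_mem hv)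
  rw [h.evalSeries_eq h0 hv] at h1
  refine mul_left_cancel₀ hpos.ne' ?_
  linear_combination h1

/-- The value of the flux at the logarithmic singularity. -/
lemma tsum_coeff_flux (h : IsLegendreSolution W) (h0 : coeff 0 W = 1) :
    ∑' j, coeff j (flux W) = 1 / Real.pi := by
  -- Abel's theorem gives the sum as a limit for `v → 1⁻`; then also `z → 1⁻`, where the
  -- hypergeometric flux has a known limit.
  have h1 : Tendsto (evalSeries (flux W)) (𝓝[<] 1) (𝓝 (∑' j, coeff j (flux W))) :=
    Real.tendsto_tsum_powerSeries_nhdsWithin_lt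
      h.summable_abs_coeff_flux.of_abs.hasSum.tendsto_sum_nat
  have h2 : Tendsto halfVersine (𝓝[<] 1) (𝓝[<] 1) := by
    refine tendsto_nhdsWithin_iff.2 ⟨?_, ?_⟩
    · have := continuous_halfVersine.tendsto 1
      rw [show halfVersine 1 = 1 by norm_num [halfVersine]] at this
      exact this.mono_left nhdsWithin_le_nhds
    · filter_upwards [Ioo_mem_nhdsLT (zero_lt_one' ℝ)] with x hx
      exact (halfVersine_mem hx).2
  refine tendsto_nhds_unique h1 ((tendsto_evalSeries_hypergeometricFlux.comp h2).congr' ?_)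
  filter_upwards [Ioo_mem_nhdsLT (zero_lt_one' ℝ)] with x hx
  exact (h.evalSeries_flux_eq h0 hx).symm

end IsLegendreSolution

end

/-! ### Asymptotics of products with a geometrically decaying factor -/

lemma GeometricDecay.exists_abs_sum_sub_tsum_le {p : ℝ⟦X⟧} (hp : GeometricDecay p) :
    ∃ B : ℝ, ∀ n : ℕ, |∑ j ∈ Finset.range (n + 1), coeff j p - ∑' j, coeff j p| ≤
      B / ((n : ℝ) + 1) := by
  have hs := hp.summable 2
  have h0 := hp.summable 0
  simp only [pow_zero, mul_one] at h0
  exact ⟨_, abs_sum_sub_tsum_le h0.of_abs fun j => hs.le_tsum j fun i _ => by positivity⟩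

lemma GeometricDecay.abs_coeff_mul_sub_div_le {p q : ℝ⟦X⟧} (hp : GeometricDecay p) {L K : ℝ}
    (hq : ∀ n : ℕ, |coeff n q - L / ((n : ℝ) + 1)| * ((n : ℝ) + 1) ^ 2 ≤ K) :
    ∃ K' : ℝ, ∀ n : ℕ, |coeff n (p * q) - L * (∑' j, coeff j p) / ((n : ℝ) + 1)| *
      ((n : ℝ) + 1) ^ 2 ≤ K' := by
  set h : ℝ⟦X⟧ := mk fun n => 1 / ((n : ℝ) + 1) with hh
  set r : ℝ⟦X⟧ := q - PowerSeries.C L * h with hr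
  have hr' : ∀ n : ℕ, |coeff n r| * ((n : ℝ) + 1) ^ 2 ≤ K := by
    intro n
    have := hq n
    rw [hr, map_sub, PowerSeries.coeff_C_mul, hh, PowerSeries.coeff_mk, mul_one_div]
    exact this
  obtain ⟨R, hR⟩ := hp.abs_coeff_mul_le 2 hr'
  obtain ⟨B, hB⟩ := hp.exists_abs_sum_sub_tsum_le
  set p' : ℝ⟦X⟧ := PowerSeries.X * PowerSeries.derivative ℝ p with hp'
  have hs : Summable fun i : ℕ => |coeff i p'| * ((i : ℝ) + 1) ^ 1 := by
    refine Summable.of_nonneg_of_le (fun i => by positivity) (fun i => ?_) (hp.summable 2)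
    rw [hp', coeff_X_mul_derivative, abs_mul, Nat.abs_cast, pow_one, sq]
    have := abs_nonneg (coeff i p)
    have hi : (0 : ℝ) ≤ i := i.cast_nonneg
    nlinarith [mul_nonneg this hi]
  have hD : ∀ n : ℕ, |coeff n (p' * h)| * ((n : ℝ) + 1) ^ 1 ≤ (∑' i : ℕ, |coeff i p'| *
      ((i : ℝ) + 1) ^ 1) * 1 := fun n =>
    abs_coeff_mul_le_of_weight (w := fun n => ((n : ℝ) + 1) ^ 1) (fun n => by positivity)
      (succ_pow_submultiplicative 1) hs fun j _ => by
        rw [hh, PowerSeries.coeff_mk, abs_of_pos (by positivity), pow_one,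
          one_div_mul_cancel (by positivity)]
  set D := (∑' i : ℕ, |coeff i p'| * ((i : ℝ) + 1) ^ 1) * 1
  refine ⟨R + |L| * (D + B), fun n => ?_⟩
  have hx : (0 : ℝ) < (n : ℝ) + 1 := by positivity
  -- Splitting `n + 1 = i + (n - i + 1)` in each term of the convolution: the second part cancels
  -- the denominator of `h`, the first replaces `p` by `ϑp`, which still has summable weighted
  -- coefficients.
  have key : coeff n (p * h) * ((n : ℝ) + 1) = coeff n (p' * h) +
      ∑ j ∈ Finset.range (n + 1), coeff j p := by
    rw [PowerSeries.coeff_mul, PowerSeries.coeff_mul,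
      Finset.Nat.sum_antidiagonal_eq_sum_range_succ_mk,
      Finset.Nat.sum_antidiagonal_eq_sum_range_succ_mk, Finset.sum_mul, ← Finset.sum_add_distrib]
    refine Finset.sum_congr rfl fun i hi => ?_
    have hi' : i ≤ n := by simpa [Nat.lt_succ_iff] using hi
    obtain ⟨j, rfl⟩ := Nat.exists_eq_add_of_le hi'
    simp only [hh, hp', coeff_X_mul_derivative, PowerSeries.coeff_mk, Nat.add_sub_cancel_left]
    push_cast
    field_simp
    ring
  set σ := ∑' j, coeff j p
  set s := ∑ j ∈ Finset.range (n + 1), coeff j p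
  have h1 : coeff n (p * q) = L * coeff n (p * h) + coeff n (p * r) := by
    rw [hr, mul_sub, map_sub, show p * (PowerSeries.C L * h) = PowerSeries.C L * (p * h) by ring,
      PowerSeries.coeff_C_mul]
    ring
  have h2 : (coeff n (p * q) - L * σ / ((n : ℝ) + 1)) * ((n : ℝ) + 1) ^ 2 =
      coeff n (p * r) * ((n : ℝ) + 1) ^ 2 +
        L * (coeff n (p' * h) * ((n : ℝ) + 1) ^ 1 + (s - σ) * ((n : ℝ) + 1)) := by
    have h3 : L * σ / ((n : ℝ) + 1) * ((n : ℝ) + 1) ^ 2 = L * σ * ((n : ℝ) + 1) := by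
      field_simp
    rw [h1]
    linear_combination L * ((n : ℝ) + 1) * key - h3
  have h4 : |s - σ| * ((n : ℝ) + 1) ≤ B := (le_div_iff₀ hx).1 (hB n)
  have h5 : ∀ a : ℝ, |a| * ((n : ℝ) + 1) ^ 2 = |a * ((n : ℝ) + 1) ^ 2| := fun a => by
    rw [abs_mul, abs_of_pos (by positivity : 0 < ((n : ℝ) + 1) ^ 2)]
  rw [h5, h2]
  refine (abs_add_le _ _).trans (add_le_add ?_ ?_)
  · rw [← h5]
    exact hR n
  · rw [abs_mul]
    refine mul_le_mul_of_nonneg_left ((abs_add_le _ _).trans (add_le_add ?_ ?_)) (abs_nonneg _)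
    · rw [abs_mul, abs_of_pos (by positivity : 0 < ((n : ℝ) + 1) ^ 1)]
      exact hD n
    · rw [abs_mul, abs_of_pos hx]
      exact h4

lemma GeometricDecay.abs_coeff_mul_sub_log_le {p q : ℝ⟦X⟧} (hp : GeometricDecay p) {L K : ℝ}
    (hq : ∀ n : ℕ, |coeff n q - L * Real.log ((n : ℝ) + 1)| ≤ K) :
    ∃ K' : ℝ, ∀ n : ℕ,
      |coeff n (p * q) - L * (∑' j, coeff j p) * Real.log ((n : ℝ) + 1)| ≤ K' := by
  set h : ℝ⟦X⟧ := mk fun n => Real.log ((n : ℝ) + 1) with hh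
  set r : ℝ⟦X⟧ := q - PowerSeries.C L * h with hr
  have hr' : ∀ n : ℕ, |coeff n r| * ((n : ℝ) + 1) ^ 0 ≤ K := by
    intro n
    have := hq n
    rw [pow_zero, mul_one, hr, map_sub, PowerSeries.coeff_C_mul, hh, PowerSeries.coeff_mk]
    exact this
  obtain ⟨R, hR⟩ := hp.abs_coeff_mul_le 0 hr'
  obtain ⟨B, hB⟩ := hp.exists_abs_sum_sub_tsum_le
  have hs := hp.summable 1
  set D := ∑' i : ℕ, |coeff i p| * ((i : ℝ) + 1) ^ 1
  refine ⟨R + |L| * (D + B), fun n => ?_⟩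
  have hx : (0 : ℝ) < (n : ℝ) + 1 := by positivity
  set σ := ∑' j, coeff j p
  set s := ∑ j ∈ Finset.range (n + 1), coeff j p with hsdef
  have h1 : coeff n (p * q) = L * coeff n (p * h) + coeff n (p * r) := by
    rw [hr, mul_sub, map_sub, show p * (PowerSeries.C L * h) = PowerSeries.C L * (p * h) by ring,
      PowerSeries.coeff_C_mul]
    ring
  -- Replacing `log(n - i + 1)` by `log(n + 1)` costs at most `i`, which the decay of `p` absorbs.
  have h2 : |coeff n (p * h) - s * Real.log ((n : ℝ) + 1)| ≤ D := by
    rw [PowerSeries.coeff_mul, Finset.Nat.sum_antidiagonal_eq_sum_range_succ_mk, hsdef,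
      Finset.sum_mul, ← Finset.sum_sub_distrib]
    refine (Finset.abs_sum_le_sum_abs _ _).trans (le_trans (Finset.sum_le_sum fun i hi => ?_)
      (hs.sum_le_tsum (Finset.range (n + 1)) fun i _ => by positivity))
    have hi' : i ≤ n := by simpa [Nat.lt_succ_iff] using hi
    obtain ⟨j, rfl⟩ := Nat.exists_eq_add_of_le hi'
    simp only [hh, PowerSeries.coeff_mk, Nat.add_sub_cancel_left]
    rw [← mul_sub, abs_mul]
    refine mul_le_mul_of_nonneg_left ?_ (abs_nonneg _)
    have hi0 : (0 : ℝ) ≤ i := i.cast_nonneg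
    have hj0 : (0 : ℝ) ≤ j := j.cast_nonneg
    have h3 : Real.log ((j : ℝ) + 1) ≤ Real.log (((i + j : ℕ) : ℝ) + 1) :=
      Real.log_le_log (by positivity) (by push_cast; linarith)
    have h4 := Real.log_le_sub_one_of_pos
      (by positivity : 0 < (((i + j : ℕ) : ℝ) + 1) / ((j : ℝ) + 1))
    rw [Real.log_div (by positivity) (by positivity)] at h4
    have h5 : (((i + j : ℕ) : ℝ) + 1) / ((j : ℝ) + 1) - 1 ≤ i := by
      rw [sub_le_iff_le_add, div_le_iff₀ (by positivity)]
      push_cast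
      nlinarith [mul_nonneg hi0 hj0]
    rw [abs_of_nonpos (by linarith), pow_one]
    linarith
  have hlog0 : 0 ≤ Real.log ((n : ℝ) + 1) := Real.log_nonneg (by linarith [n.cast_nonneg (α := ℝ)])
  have h6 : |(s - σ) * Real.log ((n : ℝ) + 1)| ≤ B := by
    have h7 : |s - σ| * ((n : ℝ) + 1) ≤ B := (le_div_iff₀ hx).1 (hB n)
    have h8 := Real.log_le_sub_one_of_pos hx
    rw [abs_mul, abs_of_nonneg hlog0]
    refine (mul_le_mul_of_nonneg_left ?_ (abs_nonneg _)).trans h7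
    linarith
  have h9 : coeff n (p * q) - L * σ * Real.log ((n : ℝ) + 1) = coeff n (p * r) +
      L * ((coeff n (p * h) - s * Real.log ((n : ℝ) + 1)) + (s - σ) * Real.log ((n : ℝ) + 1)) := by
    rw [h1]
    ring
  rw [h9]
  refine (abs_add_le _ _).trans (add_le_add (by simpa using hR n) ?_)
  rw [abs_mul]
  exact mul_le_mul_of_nonneg_left ((abs_add_le _ _).trans (add_le_add h2 h6)) (abs_nonneg _)

/-! ### Values of the half-angle factors at `v = 1` -/

lemma evalSeries_sincSeries_quarter : evalSeries sincSeries (1 / 4) = 2 / Real.pi := by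
  have hpi := Real.pi_pos
  have h : √(1 / 4 : ℝ) = 1 / 2 := by
    rw [show (1 / 4 : ℝ) = (1 / 2) ^ 2 by norm_num, Real.sqrt_sq (by norm_num)]
  rw [evalSeries_sincSeries (by norm_num), h, mul_one_div, Real.sin_pi_div_two]
  field_simp

lemma tsum_coeff_sincHalfSeries : ∑' j, coeff j sincHalfSeries = 2 / Real.pi := by
  rw [← evalSeries_sincSeries_quarter, evalSeries]
  refine tsum_congr fun j => ?_
  rw [sincHalfSeries, PowerSeries.coeff_rescale, mul_comm]

lemma tsum_coeff_cscHalfSeries : ∑' j, coeff j cscHalfSeries = Real.pi / 2 := by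
  have hpi := Real.pi_pos
  have h1 : ∑' j, coeff j cscHalfSeries = evalSeries cscSeries (1 / 4) := by
    rw [evalSeries]
    refine tsum_congr fun j => ?_
    rw [cscHalfSeries, PowerSeries.coeff_rescale, mul_comm]
  have h2 := evalSeries_mul geometricDecay_sincSeries.polynomialGrowth
    (.of_bounded abs_coeff_cscSeries_le) (x := 1 / 4) (by rw [abs_of_pos] <;> norm_num)
  have h3 : evalSeries 1 (1 / 4) = 1 := by
    rw [evalSeries, tsum_eq_single 0 fun n hn => by simp [PowerSeries.coeff_one, hn]]
    simp
  rw [sincSeries_mul_cscSeries, h3, evalSeries_sincSeries_quarter] at h2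
  rw [h1]
  field_simp at h2
  linarith

/-! ### Coefficient asymptotics of the two products -/

namespace IsLegendreSolution

variable {W : ℝ⟦X⟧}

lemma exists_abs_coeff_sub_div_le (h : IsLegendreSolution W) (h0 : coeff 0 W = 1) :
    ∃ K : ℝ, ∀ n : ℕ, |coeff n W - 2 / Real.pi / ((n : ℝ) + 1)| * ((n : ℝ) + 1) ^ 2 ≤ K := by
  have h1 := h.exists_abs_coeff_sub_le
  rw [h.tsum_coeff_flux h0, mul_one_div] at h1
  exact h1

lemma exists_abs_coeff_cscHalfSeries_mul_le (h : IsLegendreSolution W) (h0 : coeff 0 W = 1) :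
    ∃ K : ℝ, ∀ n : ℕ, |coeff n (cscHalfSeries * W) - 1 / ((n : ℝ) + 1)| *
      ((n : ℝ) + 1) ^ 2 ≤ K := by
  obtain ⟨K, hK⟩ := h.exists_abs_coeff_sub_div_le h0
  have h1 := geometricDecay_cscHalfSeries.abs_coeff_mul_sub_div_le hK
  have hpi := Real.pi_pos
  rw [tsum_coeff_cscHalfSeries, show 2 / Real.pi * (Real.pi / 2) = 1 by field_simp] at h1
  exact h1

lemma exists_abs_sum_coeff_sub_log_le (h : IsLegendreSolution W) (h0 : coeff 0 W = 1) :
    ∃ K : ℝ, ∀ n : ℕ, |∑ j ∈ Finset.range (n + 1), coeff j W -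
      2 / Real.pi * Real.log ((n : ℝ) + 1)| ≤ K := by
  obtain ⟨K, hK⟩ := h.exists_abs_coeff_sub_div_le h0
  have hpi := Real.pi_pos
  have hsum : Summable fun n : ℕ => K * (1 / ((n : ℝ) + 1) ^ 2) := by
    have h1 := (summable_nat_add_iff 1).2 (Real.summable_one_div_nat_pow.2 one_lt_two)
    refine (h1.mul_left K).congr fun n => ?_
    push_cast
    rfl
  have hK0 : 0 ≤ K := le_trans (by positivity) (hK 0)
  -- The series bounds the accumulated errors of the `W_j`; the term `2/π` covers `H_{n+1} -
  -- log(n+1)`, which lies between 0 and 1.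
  refine ⟨(∑' n : ℕ, K * (1 / ((n : ℝ) + 1) ^ 2)) + 2 / Real.pi, fun n => ?_⟩
  set H : ℝ := ∑ j ∈ Finset.range (n + 1), ((j : ℝ) + 1)⁻¹ with hH
  have hH' : ((harmonic (n + 1) : ℚ) : ℝ) = H := by
    rw [harmonic]
    push_cast
    rfl
  have h1 := harmonic_le_one_add_log (n + 1)
  have h2 := log_add_one_le_harmonic (n + 1)
  rw [hH'] at h1 h2
  have h3 : Real.log ((n : ℝ) + 1) ≤ Real.log ((n + 1 + 1 : ℕ) : ℝ) :=
    Real.log_le_log (by positivity) (by push_cast; linarith)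
  rw [Nat.cast_succ] at h1
  have h4 : ∑ j ∈ Finset.range (n + 1), coeff j W - 2 / Real.pi * Real.log ((n : ℝ) + 1) =
      ∑ j ∈ Finset.range (n + 1), (coeff j W - 2 / Real.pi / ((j : ℝ) + 1)) +
        2 / Real.pi * (H - Real.log ((n : ℝ) + 1)) := by
    rw [Finset.sum_sub_distrib]
    simp only [div_eq_mul_inv (2 / Real.pi) _]
    rw [← Finset.mul_sum, ← hH]
    ring
  rw [h4]
  refine (abs_add_le _ _).trans (add_le_add ?_ ?_)
  · refine (Finset.abs_sum_le_sum_abs _ _).trans (le_trans (Finset.sum_le_sum fun j _ => ?_)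
      (hsum.sum_le_tsum (Finset.range (n + 1)) fun i _ => by positivity))
    rw [mul_one_div, le_div_iff₀ (by positivity)]
    exact hK j
  · rw [abs_mul, abs_of_pos (by positivity : 0 < 2 / Real.pi)]
    refine mul_le_of_le_one_right (by positivity) ?_
    rw [abs_le]
    constructor <;> linarith

/-- The pole of `1/S` doubles the partial sums of `W`, giving `(4/π) log n`, and the half-angle sine
contributes its value `2/π` at `v = 1`. -/
lemma exists_abs_coeff_sincHalfSeries_mul_le (h : IsLegendreSolution W) (h0 : coeff 0 W = 1) :
    ∃ K : ℝ, ∀ n : ℕ, |coeff n (sincHalfSeries * (cscSeries * W)) -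
      8 / Real.pi ^ 2 * Real.log ((n : ℝ) + 1)| ≤ K := by
  obtain ⟨K, hK⟩ := h.exists_abs_sum_coeff_sub_log_le h0
  obtain ⟨M, _, hM⟩ := h.exists_abs_coeff_le
  obtain ⟨R, hR⟩ := geometricDecay_cscRemainder.abs_coeff_mul_le (q := W) 0 (B := M)
    (fun j => by simpa using hM j)
  have h1 : ∀ n : ℕ, |coeff n (cscSeries * W) - 4 / Real.pi * Real.log ((n : ℝ) + 1)| ≤
      2 * K + R := by
    intro n
    have h2 : coeff n (cscSeries * W) - 4 / Real.pi * Real.log ((n : ℝ) + 1) =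
        2 * (∑ j ∈ Finset.range (n + 1), coeff j W - 2 / Real.pi * Real.log ((n : ℝ) + 1)) +
          coeff n (cscRemainder * W) := by
      rw [coeff_cscSeries_mul]
      ring
    rw [h2]
    refine (abs_add_le _ _).trans (add_le_add ?_ (by simpa using hR n))
    rw [abs_mul, abs_two]
    exact mul_le_mul_of_nonneg_left (hK n) zero_le_two
  have h3 := geometricDecay_sincHalfSeries.abs_coeff_mul_sub_log_le h1
  rw [tsum_coeff_sincHalfSeries, show 4 / Real.pi * (2 / Real.pi) = 8 / Real.pi ^ 2 by
    rw [div_mul_div_comm, sq]; norm_num] at h3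
  exact h3

end IsLegendreSolution

/-! ### Conclusion -/

lemma isLegendreSolution_legendreSeries {α : ℕ → ℝ} (hα : IsLandauExpansion α) :
    IsLegendreSolution (legendreSeries α) := legendreSeries_ode hα

theorem corollary2 (α : ℕ → ℝ) (hα : IsLandauExpansion α) :
    (∃ δ : ℕ → ℝ, δ =O[atTop] (fun k : ℕ => 1 / (k : ℝ)) ∧
      ∀ k : ℕ, 1 ≤ k →
        α (2 * k) = (-1 : ℝ) ^ (k + 1) *
          (2 * ((2 * k - 2)! : ℝ) / (2 * Real.pi) ^ (2 * k)) * (1 + δ k)) ∧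
    (∃ δ : ℕ → ℝ, δ =O[atTop] (fun k : ℕ => 1 / Real.log (k : ℝ)) ∧
      ∀ k : ℕ, 1 ≤ k →
        α (2 * k + 1) = (-1 : ℝ) ^ (k + 1) *
          (8 * ((2 * k)! : ℝ) * Real.log (2 * (k : ℝ) + 1) / (2 * Real.pi) ^ (2 * k + 2)) *
            (1 + δ k)) := by
  have hW := isLegendreSolution_legendreSeries hα
  have hW0 : coeff 0 (legendreSeries α) = 1 := coeff_zero_legendreSeries
  have hpi := Real.pi_pos
  constructor
  · obtain ⟨K, hK⟩ := hW.exists_abs_coeff_cscHalfSeries_mul_le hW0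
    set e : ℕ → ℝ := fun k => coeff k (cscHalfSeries * legendreSeries α)
    -- Forced by `(2k-1)! = (2k-1) (2k-2)!`. As `e k` is `1/(k+1)` up to `O(1/k²)`, what remains is
    -- `O(1/k)`: `K` bounds the error of `e k` and 2 the explicit term `3/(2(k+1))`, both times `k`.
    refine ⟨fun k => (2 * (k : ℝ) - 1) / 2 * e k - 1, IsBigO.of_bound (K + 2) ?_, fun k hk => ?_⟩
    · filter_upwards [eventually_ge_atTop 1] with k hk
      have hk' : (1 : ℝ) ≤ k := by exact_mod_cast hk
      have h1 : |e k - 1 / ((k : ℝ) + 1)| * ((k : ℝ) + 1) ^ 2 ≤ K := hK k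
      rw [Real.norm_eq_abs, Real.norm_of_nonneg (by positivity), mul_one_div,
        le_div_iff₀ (by linarith)]
      set d := e k - 1 / ((k : ℝ) + 1) with hd
      have h2 : (2 * (k : ℝ) - 1) / 2 * e k - 1 =
          (2 * (k : ℝ) - 1) / 2 * d - 3 / (2 * ((k : ℝ) + 1)) := by
        rw [hd]
        field_simp
        ring
      have h3 : |(2 * (k : ℝ) - 1) / 2 * d| * k ≤ K := by
        rw [abs_mul, abs_of_pos (by linarith : 0 < (2 * (k : ℝ) - 1) / 2)]
        nlinarith [abs_nonneg d]
      have h4 : |3 / (2 * ((k : ℝ) + 1))| * k ≤ 2 := by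
        rw [abs_of_pos (by positivity), div_mul_eq_mul_div, div_le_iff₀ (by positivity)]
        linarith
      rw [h2]
      have h5 := mul_le_mul_of_nonneg_right
        (abs_sub ((2 * (k : ℝ) - 1) / 2 * d) (3 / (2 * ((k : ℝ) + 1)))) (by linarith : (0 : ℝ) ≤ k)
      linarith
    · rw [expansion_coeff_even hα hk]
      obtain ⟨k, rfl⟩ := Nat.exists_eq_add_of_le' hk
      rw [show 2 * (k + 1) - 1 = 2 * k + 1 by omega, show 2 * (k + 1) - 2 = 2 * k by omega,
        Nat.factorial_succ]
      push_cast
      ring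
  · obtain ⟨K, hK⟩ := hW.exists_abs_coeff_sincHalfSeries_mul_le hW0
    set e : ℕ → ℝ := fun k => coeff k (sincHalfSeries * (cscSeries * legendreSeries α))
    -- The factor is `(1/4)(2π)²/8 = π²/8`. In the bound, `2K` comes from `π²/8 ≤ 2` and 1 from
    -- `log(2k+1) - log(k+1) ≤ log 2`.
    refine ⟨fun k => Real.pi ^ 2 / 8 * e k / Real.log (2 * (k : ℝ) + 1) - 1,
      IsBigO.of_bound (2 * K + 1) ?_, fun k hk => ?_⟩
    · filter_upwards [eventually_ge_atTop 2] with k hk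
      have hk' : (2 : ℝ) ≤ k := by exact_mod_cast hk
      have h1 : |e k - 8 / Real.pi ^ 2 * Real.log ((k : ℝ) + 1)| ≤ K := hK k
      have hK0 : 0 ≤ K := (abs_nonneg _).trans h1
      have hlog : 0 < Real.log k := Real.log_pos (by linarith)
      have hlog2 : Real.log k ≤ Real.log (2 * (k : ℝ) + 1) :=
        Real.log_le_log (by linarith) (by linarith)
      have hlog3 : Real.log ((k : ℝ) + 1) ≤ Real.log (2 * (k : ℝ) + 1) :=
        Real.log_le_log (by linarith) (by linarith)
      have hlog4 : Real.log (2 * (k : ℝ) + 1) ≤ Real.log ((k : ℝ) + 1) + 1 := by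
        have h2 : Real.log (2 * (k : ℝ) + 1) ≤ Real.log (2 * ((k : ℝ) + 1)) :=
          Real.log_le_log (by linarith) (by linarith)
        rw [Real.log_mul (by norm_num) (by positivity)] at h2
        linarith [Real.log_two_lt_d9]
      set ℓ := Real.log (2 * (k : ℝ) + 1)
      have hℓ : 0 < ℓ := hlog.trans_le hlog2
      rw [Real.norm_eq_abs, Real.norm_of_nonneg (by positivity), mul_one_div]
      have h3 : Real.pi ^ 2 / 8 * e k / ℓ - 1 = (Real.pi ^ 2 / 8 *
          (e k - 8 / Real.pi ^ 2 * Real.log ((k : ℝ) + 1)) +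
            (Real.log ((k : ℝ) + 1) - ℓ)) / ℓ := by
        field_simp
        ring
      rw [h3, abs_div, abs_of_pos hℓ]
      have hpi2 : Real.pi ^ 2 / 8 ≤ 2 := by nlinarith [Real.pi_lt_d2]
      refine div_le_div₀ (by positivity) ((abs_add_le _ _).trans (add_le_add ?_ ?_)) hlog hlog2
      · rw [abs_mul, abs_of_pos (by positivity)]
        exact mul_le_mul hpi2 h1 (abs_nonneg _) zero_le_two
      · rw [abs_le]
        constructor <;> linarith
    · have hℓ : 0 < Real.log (2 * (k : ℝ) + 1) := by
        have : (1 : ℝ) ≤ k := by exact_mod_cast hk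
        exact Real.log_pos (by linarith)
      rw [expansion_coeff_odd hα k, pow_add (2 * Real.pi) (2 * k) 2]
      simp only [e]
      field_simp
      ring
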